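/- For an integer $n\ge 1$ let $s_n$ be the number of pairs of bijections $\pi_1,\pi_2:\{1,\dots,n\}\to\mathbb{Z}/n\mathbb{Z}$ whose pointwise sum $\pi_1+\pi_2$ is also a bijection. (1) For odd $n$, $$s_n=(e^{-1/2}+o(1))\,\frac{n!^3}{n^{n-1}},$$ where $o(1)\to 0$ as $n\to\infty$ through odd integers. (2) For every $n\ge 1$, the number $s_n/n!$ is equal to each of the following: the number of orthomorphisms of $\mathbb{Z}/n\mathbb{Z}$, that is, of permutations $\pi$ of $\mathbb{Z}/n\mathbb{Z}$ such that $x\mapsto\pi(x)-x$ is also a permutation; the number of arrangements of $n$ mutually nonattacking semiqueens on the $n\times n$ toroidal chessboard, where a semiqueen moves any distance horizontally, vertically, or diagonally in the northeast-southwest direction; and the number of transversals of the cyclic Latin square of order $n$ (the square with rows and columns indexed by $\mathbb{Z}/n\mathbb{Z}$ and entry $i+j$ in position $(i,j)$), a transversal being a set of $n$ cells no two of which share a row, a column or a symbol. (3) (Vardi's conjecture) There are constants $c_1>0$ and $c_2<1$ such that $c_1^n\, n!^2\le s_n\le c_2^n\, n!^2$ for every sufficiently large odd $n$. (4) (Wanless's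 conjecture) As $n\to\infty$ through odd integers, $\frac1n\log\left(s_n/n!^2\right)\to -1$. -/

import Mathlib

open Filter Topology
open scoped Nat

namespace Semiqueens

/-- Pairs of bijections from an `n`-element index set to `ℤ/nℤ` (the index set `{1, …, n}` is
modelled by `Fin n`) whose pointwise sum is again a bijection. -/
def additivePairs (n : ℕ) : Set ((Fin n → ZMod n) × (Fin n → ZMod n)) :=
  {p | Function.Bijective p.1 ∧ Function.Bijective p.2 ∧
    Function.Bijective (fun i => p.1 i + p.2 i)}

/-- The number `s_n` of such pairs. -/
noncomputable def s (n : ℕ) : ℕ := (additivePairs n).ncard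

/-- Orthomorphisms of `ℤ/nℤ`: permutations `π` such that `x ↦ π x - x` is also a permutation. -/
def orthomorphisms (n : ℕ) : Set (Equiv.Perm (ZMod n)) :=
  {π | Function.Bijective (fun x => π x - x)}

/-- A semiqueen on the square `p` of the toroidal `n × n` board attacks the other square `q` when
`q` is reached from `p` by moving some distance `k` horizontally, vertically, or diagonally in
the northeast-southwest direction (coordinates: first one eastwards, second one northwards). -/
def SemiqueenAttacks (n : ℕ) (p q : ZMod n × ZMod n) : Prop :=
  p ≠ q ∧ ∃ k : ZMod n, q = p + (k, 0) ∨ q = p + (0, k) ∨ q = p + (k, k)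

/-- Arrangements of `n` mutually nonattacking semiqueens on the toroidal `n × n` board. -/
def semiqueenArrangements (n : ℕ) : Set (Finset (ZMod n × ZMod n)) :=
  {A | A.card = n ∧ ∀ p ∈ A, ∀ q ∈ A, ¬ SemiqueenAttacks n p q}

/-- The cyclic Latin square, with entry `i + j` in row `i` and column `j`. -/
def cyclicLatinSquare (n : ℕ) (i j : ZMod n) : ZMod n := i + j

/-- A transversal of an `n × n` square `L` with rows and columns indexed by `ι`: a set of `n`
cells, no two of which share their row, their column or their symbol. -/
def IsTransversal {ι σ : Type*} (L : ι → ι → σ) (T : Finset (ι × ι)) : Prop :=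
  T.card = Nat.card ι ∧
    ∀ p ∈ T, ∀ q ∈ T, p ≠ q → p.1 ≠ q.1 ∧ p.2 ≠ q.2 ∧ L p.1 p.2 ≠ L q.1 q.2

/-- The transversals of the cyclic Latin square of order `n`. -/
def cyclicTransversals (n : ℕ) : Set (Finset (ZMod n × ZMod n)) :=
  {T | IsTransversal (cyclicLatinSquare n) T}

end Semiqueens

/-!
The number `s n` is a convolution count on the group `(ℤ/nℤ)ⁿ`: it counts the triples of bijections
with zero sum. Hence it is, up to normalization, the sum of the cubes of the Fourier coefficients
`permMean r` of the uniform measure on bijections, over all frequency vectors `r` (`sum_permMean_cube`),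
and the asymptotic formula says that this sum is `(exp (-1 / 2) + o(1)) n`. For odd `n` the
coefficients are invariant under adding a constant to `r`, which accounts for the factor `n`, and the
vectors `r` are sorted by the size `m` of their support after the best such translation.

* For fixed `m`, moving the value of one coordinate of `r` onto another coordinate and summing over
  the target gives zero. This expresses `permMean r` through vectors of smaller support
  (`permMean_recursion`). In the cube only the terms in which two coordinates cancel survive, and the
  third moment `a m` at support size `m` satisfies `a (m + 2) = -a m / (m + 2)` in the limit
  (`tendsto_thirdMoment`). So the `a m` are the coefficients of `exp (-x ^ 2 / 2)`, whose sum is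
  `exp (-1 / 2)`.
* For large `m` two bounds are combined. The second moments at support size `m` satisfy an exact
  three-term recursion, again from `permMean_recursion`, which bounds them, up to a
  factor `3 ^ m`, by the square root of the trivial bound (`secondMoment_le`). Pointwise, `permMean r` is, up to a multinomial coefficient, a
  coefficient of the circulant determinant `∏ g, ∑ a, x a * e(a g / n)`. Bounding this product by the
  inequality of the means and Parseval gives square-root cancellation in terms of the number of
  rearrangements of `r` (`norm_permMean_sq_le`).
* If `r` has many distinct values, the number of rearrangements is superexponential and the product
  of the two bounds is tiny. If `r` has few distinct values, then there are few classes of such vectors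
  under rearrangement, and the pointwise bound is summed over the classes. This gives geometric decay
  for `M ≤ m ≤ δ n` (`exists_absThirdMoment_le`) and an exponentially small contribution of the vectors
  without a dominant value (`eventually_sum_norm_cube_le`).

Dominated convergence over `m` yields the asymptotic formula. The other counting problems are related
to `s n` by explicit bijections, and the two conjectures follow from the formula by Stirling's
estimates.
-/

namespace Semiqueens

open Finset

/-! ### The equivalent counting problems -/

/-- An additive pair `(π₁, π₂)` is determined by `π₁` and the orthomorphism
`(π₁ + π₂) ∘ π₁⁻¹`, and these two data are arbitrary. -/
noncomputable def additivePairsEquiv (n : ℕ) :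
    additivePairs n ≃ (Fin n ≃ ZMod n) × orthomorphisms n where
  toFun p := (Equiv.ofBijective _ p.2.1,
    ⟨(Equiv.ofBijective _ p.2.1).symm.trans (Equiv.ofBijective _ p.2.2.2), by
      have h : (fun x => ((Equiv.ofBijective _ p.2.1).symm.trans
          (Equiv.ofBijective _ p.2.2.2)) x - x) = p.1.2 ∘ (Equiv.ofBijective _ p.2.1).symm := by
        funext x
        obtain ⟨i, rfl⟩ := (Equiv.ofBijective _ p.2.1).surjective x
        simp
      simp only [orthomorphisms, Set.mem_ofPred_eq]
      rw [h]
      exact p.2.2.1.comp (Equiv.bijective _)⟩)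
  invFun q := ⟨(q.1, fun i => q.2.1 (q.1 i) - q.1 i), q.1.bijective,
    (show Function.Bijective (fun x => q.2.1 x - x) from q.2.2).comp q.1.bijective, by
      have h := q.2.1.bijective.comp q.1.bijective
      simp only [add_sub_cancel]
      exact h⟩
  left_inv p := by
    rcases p with ⟨⟨a, b⟩, h⟩
    simp
  right_inv q := by
    rcases q with ⟨e, ⟨u, h⟩⟩
    refine Prod.ext ?_ (Subtype.ext ?_)
    · ext i; rfl
    · ext x
      obtain ⟨i, rfl⟩ := e.surjective x
      simp

theorem s_eq_factorial_mul_orthomorphisms (n : ℕ) [NeZero n] :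
    s n = n ! * (orthomorphisms n).ncard := by
  rw [s, ← Nat.card_coe_set_eq, Nat.card_congr (additivePairsEquiv n), Nat.card_prod,
    Nat.card_coe_set_eq]
  congr 1
  rw [Nat.card_congr (Equiv.equivCongr (ZMod.finEquiv n).toEquiv.symm (Equiv.refl (ZMod n))
    |>.symm), Nat.card_perm, Nat.card_zmod]

/-- A transversal is the graph of a permutation along which the symbols are distinct. -/
theorem ncard_isTransversal {ι : Type*} [Fintype ι] [DecidableEq ι] (L : ι → ι → ι) :
    {T : Finset (ι × ι) | IsTransversal L T}.ncard =
      {p : Equiv.Perm ι | Function.Bijective fun x => L x (p x)}.ncard := by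
  classical
  let f : Equiv.Perm ι → Finset (ι × ι) := fun p => univ.image fun x => (x, p x)
  have hf : Function.Injective f := by
    intro p q h
    ext x
    have : (x, p x) ∈ f q := by rw [← h]; simp [f]
    simp only [f, mem_image, mem_univ, true_and, Prod.mk.injEq] at this
    obtain ⟨a, rfl, h⟩ := this
    exact h.symm
  rw [← Set.ncard_image_of_injective _ hf]
  congr 1
  ext T
  simp only [Set.mem_ofPred_eq, Set.mem_image]
  constructor
  · rintro ⟨hc, hT⟩
    have inj1 : Set.InjOn Prod.fst (T : Set (ι × ι)) := fun p hp q hq h => by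
      by_contra hne; exact (hT p hp q hq hne).1 h
    have inj2 : Set.InjOn Prod.snd (T : Set (ι × ι)) := fun p hp q hq h => by
      by_contra hne; exact (hT p hp q hq hne).2.1 h
    have im1 : T.image Prod.fst = univ := by
      rw [← card_eq_iff_eq_univ, card_image_of_injOn inj1, hc, Nat.card_eq_fintype_card]
    have ex : ∀ x, ∃ y, (x, y) ∈ T := fun x => by
      have : x ∈ T.image Prod.fst := im1 ▸ mem_univ x
      simpa using this
    choose g hg using ex
    have hgi : Function.Injective g := fun a b h => by
      have := inj2 (hg a) (hg b) h
      exact congrArg Prod.fst this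
    refine ⟨Equiv.ofBijective g (Finite.injective_iff_bijective.1 hgi),
      Finite.injective_iff_bijective.1 fun a b h => ?_, ?_⟩
    · by_contra hne
      exact (hT _ (hg a) _ (hg b) (fun h => hne (congrArg Prod.fst h))).2.2 h
    · ext ⟨a, b⟩
      simp only [f, mem_image, mem_univ, true_and, Prod.mk.injEq, Equiv.ofBijective_apply]
      constructor
      · rintro ⟨x, rfl, rfl⟩; exact hg x
      · intro h
        exact ⟨a, rfl, congrArg Prod.snd (inj1 (hg a) h rfl)⟩
  · rintro ⟨p, hp, rfl⟩
    refine ⟨?_, ?_⟩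
    · rw [card_image_of_injective _ (fun a b h => congrArg Prod.fst h), card_univ,
        Nat.card_eq_fintype_card]
    · simp only [f, mem_image, mem_univ, true_and, forall_exists_index, forall_apply_eq_imp_iff]
      intro a b hne
      have hab : a ≠ b := fun h => hne (by rw [h])
      exact ⟨hab, fun h => hab (p.injective h), fun h => hab (hp.injective h)⟩

theorem semiqueenArrangements_eq (n : ℕ) :
    semiqueenArrangements n = {T | IsTransversal (fun i j : ZMod n => j - i) T} := by
  ext A
  simp only [semiqueenArrangements, SemiqueenAttacks, IsTransversal, Set.mem_ofPred_eq,
    Nat.card_zmod]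
  refine and_congr_right fun _ => forall₄_congr fun p _ q _ => ?_
  rcases p with ⟨a, b⟩
  rcases q with ⟨c, d⟩
  have key : (∃ k, (c, d) = (a, b) + (k, 0) ∨ (c, d) = (a, b) + (0, k) ∨ (c, d) = (a, b) + (k, k)) ↔
      b = d ∨ a = c ∨ b - a = d - c := by
    simp only [Prod.mk_add_mk, Prod.mk.injEq, add_zero]
    constructor
    · rintro ⟨k, h | h | h⟩
      · exact Or.inl h.2.symm
      · exact Or.inr (Or.inl h.1.symm)
      · exact Or.inr (Or.inr (by rw [h.1, h.2]; ring))
    · rintro (h | h | h)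
      · exact ⟨c - a, Or.inl ⟨by ring, h.symm⟩⟩
      · exact ⟨d - b, Or.inr (Or.inl ⟨h.symm, by ring⟩)⟩
      · exact ⟨c - a, Or.inr (Or.inr ⟨by ring, by linear_combination -h⟩)⟩
  rw [key]
  tauto

theorem ncard_cyclicTransversals (n : ℕ) [NeZero n] :
    (cyclicTransversals n).ncard = (orthomorphisms n).ncard := by
  rw [cyclicTransversals, ncard_isTransversal, ← Nat.card_coe_set_eq, ← Nat.card_coe_set_eq]
  refine Nat.card_congr ⟨fun p => ⟨Equiv.ofBijective _ p.2, ?_⟩,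
    fun p => ⟨Equiv.ofBijective _ p.2, ?_⟩, fun p => ?_, fun p => ?_⟩
  · simp [orthomorphisms, cyclicLatinSquare]
  · change Function.Bijective fun x => x + (p.1 x - x)
    simpa only [add_sub_cancel] using p.1.bijective
  · ext x
    change x + p.1 x - x = p.1 x
    ring
  · ext x
    change x + (p.1 x - x) = p.1 x
    ring

theorem ncard_semiqueenArrangements (n : ℕ) [NeZero n] :
    (semiqueenArrangements n).ncard = (orthomorphisms n).ncard := by
  rw [semiqueenArrangements_eq, ncard_isTransversal]
  rfl

/-- Additive pairs may be counted as triples of permutations of `ℤ/nℤ` with zero sum. -/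
theorem s_eq_card_triples (n : ℕ) [NeZero n] :
    s n = Fintype.card {p : Equiv.Perm (ZMod n) × Equiv.Perm (ZMod n) × Equiv.Perm (ZMod n) //
      ∀ i, p.1 i + p.2.1 i + p.2.2 i = 0} := by
  rw [s_eq_factorial_mul_orthomorphisms, ← Nat.card_coe_set_eq, ← Nat.card_eq_fintype_card]
  have h : n ! = Nat.card (Equiv.Perm (ZMod n)) := by rw [Nat.card_perm, Nat.card_zmod]
  rw [h, ← Nat.card_prod]
  refine Nat.card_congr ⟨fun q => ⟨(q.1, q.1.trans (Equiv.ofBijective _ q.2.2),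
      (q.1.trans q.2.1).trans (Equiv.neg _)), fun i => ?_⟩,
    fun p => (p.1.1, ⟨p.1.1.symm.trans (p.1.2.2.trans (Equiv.neg _)), ?_⟩), fun q => ?_, fun p => ?_⟩
  · change q.1 i + (q.2.1 (q.1 i) - q.1 i) + -q.2.1 (q.1 i) = 0
    ring
  · have : (fun x => (p.1.1.symm.trans (p.1.2.2.trans (Equiv.neg _))) x - x) =
        p.1.2.1 ∘ p.1.1.symm := by
      funext x
      obtain ⟨i, rfl⟩ := p.1.1.surjective x
      have := p.2 i
      simp only [Equiv.trans_apply, Equiv.symm_apply_apply, Equiv.neg_apply, Function.comp_apply]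
      linear_combination -this
    simp only [orthomorphisms, Set.mem_ofPred_eq]
    rw [this]
    exact p.1.2.1.bijective.comp (Equiv.bijective _)
  · refine Prod.ext rfl (Subtype.ext ?_)
    ext x
    simp
  · rcases p with ⟨⟨a, b, c⟩, h⟩
    refine Subtype.ext (Prod.ext rfl (Prod.ext ?_ ?_))
    · ext i
      have := h i
      simp only [Equiv.trans_apply, Equiv.ofBijective_apply, Equiv.symm_apply_apply,
        Equiv.neg_apply] at this ⊢
      linear_combination -this
    · ext i; simp

/-! ### The Fourier transform of the set of bijections -/

section

variable {n : ℕ} [NeZero n]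

/-- The Fourier coefficient, at the frequency vector `r`, of the uniform probability measure on
the bijections `ℤ/nℤ → ℤ/nℤ`, viewed as a measure on `(ℤ/nℤ)ⁿ`: the mean of
`e(∑ rᵢ π(i) / n)` over all permutations `π`. -/
noncomputable def permMean (r : ZMod n → ZMod n) : ℂ :=
  (n ! : ℂ)⁻¹ * ∑ p : Equiv.Perm (ZMod n), ZMod.stdAddChar (∑ i, r i * p i)

/-- The vector with the value `v` at the coordinate `k` and zeros elsewhere. -/
abbrev coordVec (k v : ZMod n) : ZMod n → ZMod n := Pi.single k v

/-- An additive character takes sums to products. -/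
theorem addChar_sum {ι G : Type*} [AddCommMonoid G] (e : AddChar G ℂ) (t : Finset ι) (f : ι → G) :
    e (∑ i ∈ t, f i) = ∏ i ∈ t, e (f i) := by
  classical
  induction t using Finset.induction_on with
  | empty => simp
  | insert a t ha ih => rw [sum_insert ha, prod_insert ha, AddChar.map_add_eq_mul, ih]

theorem factorial_ne_zero_complex (m : ℕ) : (m ! : ℂ) ≠ 0 :=
  Nat.cast_ne_zero.2 (Nat.factorial_ne_zero m)

theorem sum_stdAddChar_mul (b : ZMod n) :
    ∑ x : ZMod n, ZMod.stdAddChar (x * b) = if b = 0 then (n : ℂ) else 0 := by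
  rw [AddChar.sum_mulShift b (ZMod.isPrimitive_stdAddChar n)]
  simp [ZMod.card]

theorem sum_stdAddChar_dotProduct (x : ZMod n → ZMod n) :
    ∑ r : ZMod n → ZMod n, ZMod.stdAddChar (∑ i, r i * x i) =
      if x = 0 then (n : ℂ) ^ n else 0 := by
  simp_rw [addChar_sum]
  have h := prod_univ_sum (fun _ : ZMod n => (univ : Finset (ZMod n)))
    (fun i v => (ZMod.stdAddChar (v * x i) : ℂ))
  rw [Fintype.piFinset_univ] at h
  rw [← h]
  simp_rw [sum_stdAddChar_mul]
  split_ifs with hx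
  · subst hx; simp [ZMod.card]
  · obtain ⟨i, hi⟩ := Function.ne_iff.1 hx
    exact prod_eq_zero (mem_univ i) (if_neg hi)

theorem permMean_comp_perm (r : ZMod n → ZMod n) (u : Equiv.Perm (ZMod n)) :
    permMean (r ∘ u) = permMean r := by
  unfold permMean
  congr 1
  refine Fintype.sum_equiv (Equiv.mulRight u⁻¹) _ _ fun p => ?_
  congr 1
  exact Fintype.sum_equiv u _ _ fun i => by simp

theorem permMean_zero : permMean (0 : ZMod n → ZMod n) = 1 := by
  have := factorial_ne_zero_complex n
  simp [permMean, Fintype.card_perm, ZMod.card, this]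

/-- For odd `n` the elements of `ℤ/nℤ` sum to zero, hence `permMean` is invariant under
translation by constant vectors. -/
theorem permMean_add_const (hn : Odd n) (r : ZMod n → ZMod n) (c : ZMod n) :
    permMean (fun i => r i + c) = permMean r := by
  have h0 : ∑ i : ZMod n, i = 0 := by
    have h2 : (2 : ZMod n) * ∑ i : ZMod n, i = 0 := by
      have h : ∑ i : ZMod n, i = ∑ i : ZMod n, -i :=
        Fintype.sum_equiv (Equiv.neg _) _ _ fun i => by simp
      rw [sum_neg_distrib] at h
      linear_combination h
    have hu : IsUnit (2 : ZMod n) := by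
      have := (ZMod.isUnit_iff_coprime 2 n).2 (Nat.coprime_two_left.2 hn)
      simpa using this
    exact (hu.mul_right_eq_zero).1 h2
  unfold permMean
  congr 1
  refine sum_congr rfl fun p _ => ?_
  congr 1
  simp_rw [add_mul, sum_add_distrib, ← mul_sum]
  rw [Equiv.sum_comp p (fun i => i), h0]
  simp

theorem sum_permMean_add_single {v : ZMod n} (hv : v ≠ 0) (r : ZMod n → ZMod n) :
    ∑ k, permMean (r + coordVec k v) = 0 := by
  unfold permMean
  rw [← mul_sum, sum_comm]
  refine mul_eq_zero_of_right _ (sum_eq_zero fun p _ => ?_)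
  have : ∀ k, (ZMod.stdAddChar (∑ i, (r + coordVec k v) i * p i) : ℂ) =
      ZMod.stdAddChar (∑ i, r i * p i) * ZMod.stdAddChar (p k * v) := fun k => by
    rw [← AddChar.map_add_eq_mul]
    congr 1
    simp [add_mul, sum_add_distrib, Pi.single_apply, mul_comm]
  simp_rw [this, ← mul_sum]
  rw [Equiv.sum_comp p (fun k => (ZMod.stdAddChar (k * v) : ℂ)), sum_stdAddChar_mul, if_neg hv,
    mul_zero]

theorem sum_permMean_sub_single {i j : ZMod n} (hij : i ≠ j) (r : ZMod n → ZMod n) :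
    ∑ v, permMean (r + coordVec i v - coordVec j v) = 0 := by
  unfold permMean
  rw [← mul_sum, sum_comm]
  refine mul_eq_zero_of_right _ (sum_eq_zero fun p _ => ?_)
  have : ∀ v, (ZMod.stdAddChar (∑ k, (r + coordVec i v - coordVec j v) k * p k) : ℂ) =
      ZMod.stdAddChar (∑ i, r i * p i) * ZMod.stdAddChar (v * (p i - p j)) := fun v => by
    rw [← AddChar.map_add_eq_mul]
    congr 1
    simp [add_mul, sub_mul, sum_add_distrib, sum_sub_distrib, Pi.single_apply, mul_sub]
    ring
  simp_rw [this, ← mul_sum]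
  rw [sum_stdAddChar_mul, if_neg (sub_ne_zero.2 fun h => hij (p.injective h)), mul_zero]

theorem permMean_add_single_swap (r : ZMod n → ZMod n) {i k : ZMod n} (h : r i = r k)
    (v : ZMod n) : permMean (r + coordVec i v) = permMean (r + coordVec k v) := by
  rw [← permMean_comp_perm (r + coordVec i v) (Equiv.swap i k)]
  congr 1
  ext j
  simp only [Function.comp_apply, Pi.add_apply, Pi.single_apply]
  rcases eq_or_ne j i with rfl | hi
  · rw [Equiv.swap_apply_left]
    rcases eq_or_ne j k with rfl | hk
    · rfl
    · simp [hk, hk.symm, h]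
  · rcases eq_or_ne j k with rfl | hk
    · simp [h]
    · rw [Equiv.swap_apply_of_ne_of_ne hi hk]
      simp [hi, hk]

/-- Moving the value `v` of one coordinate onto another one, and summing over the target, gives
zero; all targets outside the support contribute the same. This expresses `permMean` at a vector
through its values at vectors of smaller support. -/
theorem permMean_recursion (r : ZMod n → ZMod n) {i v : ZMod n} (hi : r i = 0) (hv : v ≠ 0) :
    ((n : ℂ) - hammingNorm r) * permMean (r + coordVec i v) =
      -∑ k with r k ≠ 0, permMean (r + coordVec k v) := by
  have h := sum_permMean_add_single hv r
  rw [← sum_filter_add_sum_filter_not univ (fun k => r k ≠ 0)] at h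
  have h2 : ∑ k with ¬ r k ≠ 0, permMean (r + coordVec k v) =
      ((n : ℂ) - hammingNorm r) * permMean (r + coordVec i v) := by
    rw [sum_congr rfl (g := fun _ => permMean (r + coordVec i v)), sum_const, nsmul_eq_mul]
    · congr 1
      have := card_filter_add_card_filter_not (s := (univ : Finset (ZMod n))) (fun k => r k ≠ 0)
      rw [card_univ, ZMod.card] at this
      rw [hammingNorm, eq_sub_iff_add_eq', ← Nat.cast_add, this]
    · intro k hk
      simp only [mem_filter, mem_univ, true_and, not_not] at hk
      exact permMean_add_single_swap r (hk.trans hi.symm) v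
  rw [h2] at h
  linear_combination h

theorem sum_norm_sq_permMean :
    ∑ r : ZMod n → ZMod n, ‖permMean r‖ ^ 2 = (n : ℝ) ^ n / n ! := by
  have h : ∀ r : ZMod n → ZMod n, ((‖permMean r‖ ^ 2 : ℝ) : ℂ) = (n ! : ℂ)⁻¹ ^ 2 *
      ∑ p : Equiv.Perm (ZMod n), ∑ q : Equiv.Perm (ZMod n),
        ZMod.stdAddChar (∑ i, r i * (p i - q i)) := fun r => by
    rw [Complex.ofReal_pow, ← Complex.mul_conj', permMean, map_mul, map_sum, map_inv₀,
      Complex.conj_natCast, mul_mul_mul_comm, ← sq, sum_mul_sum]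
    congr 1
    refine sum_congr rfl fun p _ => sum_congr rfl fun q _ => ?_
    rw [← AddChar.map_neg_eq_conj, ← AddChar.map_add_eq_mul]
    simp_rw [mul_sub, sum_sub_distrib, sub_eq_add_neg]
  have hC : ((∑ r : ZMod n → ZMod n, ‖permMean r‖ ^ 2 : ℝ) : ℂ) = (n : ℂ) ^ n / n ! := by
    rw [Complex.ofReal_sum]
    simp_rw [h, ← mul_sum]
    rw [sum_comm]
    simp_rw [sum_comm (s := (univ : Finset (ZMod n → ZMod n)))]
    have : ∀ p q : Equiv.Perm (ZMod n), ∑ r : ZMod n → ZMod n,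
        (ZMod.stdAddChar (∑ i, r i * (p i - q i)) : ℂ) = if q = p then (n : ℂ) ^ n else 0 := by
      intro p q
      have := sum_stdAddChar_dotProduct (fun i => p i - q i)
      rw [this]
      congr 1
      rw [funext_iff, Equiv.ext_iff]
      simp [sub_eq_zero (G := ZMod n), eq_comm]
    simp_rw [this]
    simp only [sum_ite_eq', mem_univ, if_true, sum_const, card_univ, Fintype.card_perm, ZMod.card,
      nsmul_eq_mul]
    have := factorial_ne_zero_complex n
    field_simp
  have hR : ((∑ r : ZMod n → ZMod n, ‖permMean r‖ ^ 2 : ℝ) : ℂ) = (((n : ℝ) ^ n / n ! : ℝ) : ℂ) := by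
    rw [hC]; push_cast; rfl
  exact Complex.ofReal_injective hR

/-- The third moment of the Fourier transform counts the additive pairs. -/
theorem sum_permMean_cube :
    ∑ r : ZMod n → ZMod n, permMean r ^ 3 = (n : ℂ) ^ n * s n / (n ! : ℂ) ^ 3 := by
  have h : ∀ r : ZMod n → ZMod n, permMean r ^ 3 = (n ! : ℂ)⁻¹ ^ 3 *
      ∑ p : Equiv.Perm (ZMod n) × Equiv.Perm (ZMod n) × Equiv.Perm (ZMod n),
        ZMod.stdAddChar (∑ i, r i * (p.1 i + p.2.1 i + p.2.2 i)) := fun r => by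
    rw [permMean, mul_pow]
    congr 1
    rw [Fintype.sum_prod_type, pow_three, sum_mul_sum, sum_mul_sum]
    refine sum_congr rfl fun p _ => ?_
    rw [Fintype.sum_prod_type]
    refine sum_congr rfl fun q _ => ?_
    rw [mul_sum]
    refine sum_congr rfl fun u _ => ?_
    rw [← AddChar.map_add_eq_mul, ← AddChar.map_add_eq_mul]
    simp_rw [mul_add, sum_add_distrib, add_assoc]
  simp_rw [h, ← mul_sum]
  rw [sum_comm]
  have : ∀ p : Equiv.Perm (ZMod n) × Equiv.Perm (ZMod n) × Equiv.Perm (ZMod n),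
      ∑ r : ZMod n → ZMod n, (ZMod.stdAddChar (∑ i, r i * (p.1 i + p.2.1 i + p.2.2 i)) : ℂ) =
        if ∀ i, p.1 i + p.2.1 i + p.2.2 i = 0 then (n : ℂ) ^ n else 0 := fun p => by
    rw [sum_stdAddChar_dotProduct (fun i => p.1 i + p.2.1 i + p.2.2 i)]
    simp only [funext_iff, Pi.zero_apply]
  simp_rw [this]
  rw [← sum_filter, sum_const, nsmul_eq_mul, s_eq_card_triples, Fintype.card_subtype]
  field_simp

end

/-! ### Summation over vectors of given support size -/

section

variable {n : ℕ} [NeZero n]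

theorem hammingNorm_add_coordVec (r : ZMod n → ZMod n) (k v : ZMod n) :
    hammingNorm (r + coordVec k v) + (if r k = 0 then 0 else 1) =
      hammingNorm r + (if r k + v = 0 then 0 else 1) := by
  have h : ∀ x : ZMod n → ZMod n,
      hammingNorm x = (if x k = 0 then 0 else 1) + ∑ i ∈ univ.erase k, if x i = 0 then 0 else 1 :=
    fun x => by
      rw [add_sum_erase univ (fun i => if x i = 0 then 0 else 1) (mem_univ k), hammingNorm,
        card_filter]
      exact sum_congr rfl fun i _ => by split_ifs <;> simp_all
  rw [h (r + coordVec k v), h r]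
  have : ∑ i ∈ univ.erase k, (if (r + coordVec k v) i = 0 then 0 else 1) =
      ∑ i ∈ univ.erase k, (if r i = 0 then 0 else 1) :=
    sum_congr rfl fun i hi => by
      simp [Pi.single_eq_of_ne (M := fun _ : ZMod n => ZMod n) (ne_of_mem_erase hi)]
  rw [this]
  simp only [Pi.add_apply, Pi.single_eq_same]
  ring

/-- Double counting of pairs (vector, coordinate of its support): a vector with `m + 1` nonzero
coordinates and one of these correspond to a vector with `m` nonzero coordinates, one of its zero
coordinates, and a nonzero value to put there. -/
theorem nsmul_sum_hammingNorm_succ {M : Type*} [AddCommMonoid M] (m : ℕ)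
    (g : (ZMod n → ZMod n) → M) :
    (m + 1) • ∑ r with hammingNorm r = m + 1, g r =
      ∑ i, ∑ v with v ≠ 0, ∑ r with hammingNorm r = m ∧ r i = 0, g (r + coordVec i v) := by
  have h1 : (m + 1) • ∑ r with hammingNorm r = m + 1, g r =
      ∑ i, ∑ r with hammingNorm r = m + 1 ∧ r i ≠ 0, g r := by
    simp_rw [← filter_filter, sum_filter (fun r => _ ≠ _)]
    rw [sum_comm, smul_sum]
    refine sum_congr rfl fun r hr => ?_
    rw [← sum_filter, sum_const, ← (mem_filter.1 hr).2]
    rfl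
  rw [h1]
  refine sum_congr rfl fun i _ => ?_
  rw [← sum_product' (f := fun v r => g (r + coordVec i v))]
  refine sum_nbij' (fun r => (r i, r - coordVec i (r i))) (fun p => p.2 + coordVec i p.1)
    ?_ ?_ ?_ ?_ ?_
  · intro r hr
    simp only [mem_filter, mem_univ, true_and, mem_product, Pi.sub_apply, Pi.single_eq_same,
      sub_self, and_true] at hr ⊢
    refine ⟨hr.2, ?_⟩
    have := hammingNorm_add_coordVec (r - coordVec i (r i)) i (r i)
    simp [hr.2] at this
    omega
  · rintro ⟨v, r⟩ hr
    simp only [mem_filter, mem_univ, true_and, mem_product] at hr ⊢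
    have := hammingNorm_add_coordVec r i v
    simp [hr.2.2, hr.1] at this ⊢
    omega
  · intro r _
    simp
  · rintro ⟨v, r⟩ hr
    simp only [mem_filter, mem_univ, true_and, mem_product] at hr ⊢
    simp [hr.2.2]
  · intro r _
    simp

/-- Adding `v` to a coordinate with the value `-v` removes it from the support. -/
theorem sum_add_coordVec_cancel {M : Type*} [AddCommMonoid M] (m : ℕ) {i k v : ZMod n}
    (hik : i ≠ k) (hv : v ≠ 0) (g : (ZMod n → ZMod n) → M) :
    ∑ r with hammingNorm r = m + 1 ∧ r i = 0 ∧ r k = -v, g (r + coordVec k v) =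
      ∑ r with hammingNorm r = m ∧ r i = 0 ∧ r k = 0, g r := by
  refine sum_nbij' (fun r => r + coordVec k v) (fun r => r - coordVec k v) ?_ ?_ ?_ ?_ ?_
  · intro r hr
    simp only [mem_filter, mem_univ, true_and] at hr ⊢
    have := hammingNorm_add_coordVec r k v
    simp [hr.2.2, hv, hik, hr.2.1] at this ⊢
    omega
  · intro r hr
    simp only [mem_filter, mem_univ, true_and] at hr ⊢
    have := hammingNorm_add_coordVec (r - coordVec k v) k v
    simp [hr.2.2, hv, hik, hr.2.1] at this ⊢
    omega
  · intro r _; simp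
  · intro r _; simp
  · intro r _; rfl

theorem sum_add_coordVec_of_ne {M : Type*} [AddCommMonoid M] (m : ℕ) (i k v : ZMod n)
    (g : (ZMod n → ZMod n) → M) :
    ∑ r with hammingNorm r = m ∧ r i = 0 ∧ r k ≠ 0 ∧ r k ≠ -v, g (r + coordVec k v) =
      ∑ r with hammingNorm r = m ∧ r i = 0 ∧ r k ≠ 0 ∧ r k ≠ v, g r := by
  refine sum_nbij' (fun r => r + coordVec k v) (fun r => r - coordVec k v) ?_ ?_ ?_ ?_ ?_
  · intro r hr
    simp only [mem_filter, mem_univ, true_and] at hr ⊢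
    have hik : i ≠ k := fun h => hr.2.2.1 (h ▸ hr.2.1)
    have h2 : r k + v ≠ 0 := fun h => hr.2.2.2 (eq_neg_of_add_eq_zero_left h)
    have := hammingNorm_add_coordVec r k v
    simp [hr.2.2.1, hik, hr.2.1, h2] at this ⊢
    omega
  · intro r hr
    simp only [mem_filter, mem_univ, true_and] at hr ⊢
    have hik : i ≠ k := fun h => hr.2.2.1 (h ▸ hr.2.1)
    have := hammingNorm_add_coordVec (r - coordVec k v) k v
    simp [hr.2.2.1, hik, hr.2.1, sub_eq_zero, hr.2.2.2] at this ⊢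
    omega
  · intro r _; simp
  · intro r _; simp
  · intro r _; rfl

theorem sum_support_split {M : Type*} [AddCommMonoid M] (m : ℕ) (i : ZMod n) {v : ZMod n}
    (hv : v ≠ 0) (h : ZMod n → (ZMod n → ZMod n) → M) :
    ∑ k, ∑ r with hammingNorm r = m ∧ r i = 0 ∧ r k = -v, h k r +
      ∑ k, ∑ r with hammingNorm r = m ∧ r i = 0 ∧ r k ≠ 0 ∧ r k ≠ -v, h k r =
    ∑ r with hammingNorm r = m ∧ r i = 0, ∑ k with r k ≠ 0, h k r := by
  have h1 : ∑ r with hammingNorm r = m ∧ r i = 0, ∑ k with r k ≠ 0, h k r =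
      ∑ k, ∑ r with hammingNorm r = m ∧ r i = 0 ∧ r k ≠ 0, h k r :=
    sum_comm' fun r k => by simp only [mem_filter, mem_univ, true_and]; tauto
  rw [h1, ← sum_add_distrib]
  refine sum_congr rfl fun k _ => ?_
  rw [← sum_filter_add_sum_filter_not (univ.filter fun r : ZMod n → ZMod n =>
    hammingNorm r = m ∧ r i = 0 ∧ r k ≠ 0) (fun r => r k = -v), filter_filter, filter_filter]
  congr 1
  · refine sum_congr (filter_congr fun r _ => ?_) fun _ _ => rfl
    have : r k = -v → r k ≠ 0 := fun h => by simpa [h] using hv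
    tauto
  · exact sum_congr (filter_congr fun r _ => by tauto) fun _ _ => rfl

theorem card_filter_eq_zero (r : ZMod n → ZMod n) :
    ((univ.filter fun i => r i = 0).card : ℝ) = n - hammingNorm r := by
  have := card_filter_add_card_filter_not (s := (univ : Finset (ZMod n))) (fun k => r k = 0)
  rw [card_univ, ZMod.card] at this
  rw [hammingNorm, eq_sub_iff_add_eq, ← Nat.cast_add, this]

/-! ### The second moment at given support size -/

/-- The sum of `‖permMean r‖ ^ 2` over the vectors `r` with exactly `m` nonzero coordinates. -/
noncomputable def secondMoment (n m : ℕ) [NeZero n] : ℝ :=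
  ∑ r : ZMod n → ZMod n with hammingNorm r = m, ‖permMean r‖ ^ 2

theorem permMean_coordVec (i : ZMod n) {v : ZMod n} (hv : v ≠ 0) : permMean (coordVec i v) = 0 := by
  have h := permMean_recursion (0 : ZMod n → ZMod n) (i := i) rfl hv
  simpa [NeZero.ne n] using h

theorem secondMoment_zero : secondMoment n 0 = 1 := by
  simp [secondMoment, hammingNorm_eq_zero, filter_eq', permMean_zero]

theorem secondMoment_one : secondMoment n 1 = 0 := by
  have h := nsmul_sum_hammingNorm_succ (n := n) 0 (fun r => ‖permMean r‖ ^ 2)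
  rw [zero_add, one_smul] at h
  rw [secondMoment, h]
  refine sum_eq_zero fun i _ => sum_eq_zero fun v hv => sum_eq_zero fun r hr => ?_
  simp only [mem_filter, mem_univ, true_and, hammingNorm_eq_zero] at hr hv
  rw [hr.1, zero_add, permMean_coordVec i hv]
  simp

theorem secondMoment_of_lt {m : ℕ} (h : n < m) : secondMoment n m = 0 := by
  refine sum_eq_zero fun r hr => ?_
  have h1 := (mem_filter.1 hr).2
  have h2 : hammingNorm r ≤ Fintype.card (ZMod n) := hammingNorm_le_card_fintype
  rw [ZMod.card] at h2
  omega

theorem sum_permMean_transfer {i k : ZMod n} (hik : i ≠ k) (r : ZMod n → ZMod n) :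
    ∑ v with v ≠ 0, permMean (r - coordVec k v + coordVec i v) = -permMean r := by
  have h := sum_permMean_sub_single hik r
  rw [← add_sum_erase univ _ (mem_univ 0)] at h
  have : (univ.filter fun v : ZMod n => v ≠ 0) = univ.erase 0 := by ext; simp
  rw [this, eq_neg_iff_add_eq_zero, add_comm]
  simpa [sub_add_eq_add_sub] using h

theorem sum_permMean_transfer' {i k : ZMod n} (r : ZMod n → ZMod n) (hi : r i = 0)
    (hk : r k ≠ 0) :
    ∑ v with v ≠ 0 ∧ r k ≠ v, permMean (r - coordVec k v + coordVec i v) = -(2 * permMean r) := by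
  have hik : i ≠ k := fun h => hk (h ▸ hi)
  have h := sum_permMean_transfer hik r
  rw [← add_sum_erase _ _ (show r k ∈ univ.filter fun v : ZMod n => v ≠ 0 by simpa using hk)] at h
  have h1 : (univ.filter fun v : ZMod n => v ≠ 0 ∧ r k ≠ v) =
      (univ.filter fun v : ZMod n => v ≠ 0).erase (r k) := by
    ext; simp [and_comm, eq_comm]
  have h2 : permMean (r - coordVec k (r k) + coordVec i (r k)) = permMean r := by
    rw [permMean_add_single_swap (r - coordVec k (r k)) (i := i) (k := k) (by simp [hik, hi])]
    simp
  rw [h2] at h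
  rw [h1]
  linear_combination h

/-- The second moments satisfy a three-term recursion. It follows from `permMean_recursion`, applied
to one of the two factors of `‖permMean r‖ ^ 2`, because the sums over the transferred value `v`
can be evaluated. -/
theorem secondMoment_recursion {m : ℕ} (hm : m + 2 ≤ n) :
    ((m : ℝ) + 2) * secondMoment n (m + 2) =
      (n - m) * secondMoment n m + 2 * (m + 1) * secondMoment n (m + 1) := by
  have hn : ((n : ℂ) - (m + 1 : ℕ)) ≠ 0 := by
    rw [sub_ne_zero]
    exact_mod_cast (by omega : n ≠ m + 1)
  let Q : ℕ → ℂ := fun m => ∑ r : ZMod n → ZMod n with hammingNorm r = m,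
    permMean r * starRingEnd ℂ (permMean r)
  have hQ : ∀ m, Q m = (secondMoment n m : ℂ) := fun m => by
    simp only [Q, secondMoment, Complex.ofReal_sum, Complex.ofReal_pow, Complex.mul_conj']
  have h1 := nsmul_sum_hammingNorm_succ (n := n) (m + 1)
    (fun r => permMean r * starRingEnd ℂ (permMean r))
  -- the terms of `permMean_recursion` in which `v` cancels the coordinate `k`
  have hA : ∑ i : ZMod n, ∑ k : ZMod n, ∑ v with v ≠ 0,
      ∑ r : ZMod n → ZMod n with hammingNorm r = m + 1 ∧ r i = 0 ∧ r k = -v,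
        permMean (r + coordVec k v) * starRingEnd ℂ (permMean (r + coordVec i v)) =
      -(((n : ℂ) - m) * (n - (m + 1 : ℕ)) * Q m) := by
    have : ∀ i k : ZMod n, ∑ v with v ≠ 0,
      ∑ r : ZMod n → ZMod n with hammingNorm r = m + 1 ∧ r i = 0 ∧ r k = -v,
        permMean (r + coordVec k v) * starRingEnd ℂ (permMean (r + coordVec i v)) =
        -∑ r : ZMod n → ZMod n with hammingNorm r = m,
          if r i = 0 ∧ r k = 0 ∧ i ≠ k then permMean r * starRingEnd ℂ (permMean r) else 0 := by
      intro i k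
      rcases eq_or_ne i k with rfl | hik
      · simp only [ne_eq, not_true_eq_false, and_false, if_false, sum_const_zero, neg_zero]
        refine sum_eq_zero fun v hv => ?_
        rw [filter_false_of_mem, sum_empty]
        rintro r - ⟨-, h, h'⟩
        exact (mem_filter.1 hv).2 (by simpa [h] using h')
      · have h2 : ∀ v ∈ (univ : Finset (ZMod n)).filter (fun v => v ≠ 0),
          ∑ r : ZMod n → ZMod n with hammingNorm r = m + 1 ∧ r i = 0 ∧ r k = -v,
          permMean (r + coordVec k v) * starRingEnd ℂ (permMean (r + coordVec i v)) =
          ∑ r : ZMod n → ZMod n with hammingNorm r = m ∧ r i = 0 ∧ r k = 0,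
            permMean r * starRingEnd ℂ (permMean (r - coordVec k v + coordVec i v)) := by
          intro v hv
          rw [← sum_add_coordVec_cancel m hik (mem_filter.1 hv).2]
          exact sum_congr rfl fun r _ => by rw [add_sub_cancel_right]
        rw [sum_congr rfl h2, sum_comm]
        simp_rw [← mul_sum, ← map_sum, sum_permMean_transfer hik]
        rw [← filter_filter, sum_filter, ← sum_neg_distrib]
        refine sum_congr rfl fun r _ => ?_
        simp only [hik, ne_eq, not_false_eq_true, and_true]
        split_ifs <;> simp
    simp_rw [this, sum_neg_distrib]
    rw [neg_inj]
    simp_rw [sum_comm (s := (univ : Finset (ZMod n))) (t := univ.filter fun r => hammingNorm r = m)]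
    simp only [Q, mul_sum]
    refine sum_congr rfl fun r hr => ?_
    have hc : ∑ i : ZMod n, ∑ k : ZMod n,
        (if r i = 0 ∧ r k = 0 ∧ i ≠ k then permMean r * starRingEnd ℂ (permMean r) else 0) =
        ((univ.filter fun i => r i = 0).offDiag.card : ℂ) *
          (permMean r * starRingEnd ℂ (permMean r)) := by
      rw [← sum_product', ← sum_filter, sum_const, nsmul_eq_mul]
      congr 3
      ext ⟨a, b⟩
      simp
    rw [hc, offDiag_card]
    congr 1
    have h3 := card_filter_eq_zero r
    rw [(mem_filter.1 hr).2] at h3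
    rw [Nat.cast_sub (Nat.le_mul_self _)]
    have h4 : ((univ.filter fun i => r i = 0).card : ℂ) = n - m := by exact_mod_cast congrArg Complex.ofReal h3
    push_cast
    rw [h4]
    ring
  -- the terms in which the coordinate `k` stays nonzero
  have hB : ∑ i : ZMod n, ∑ k : ZMod n, ∑ v with v ≠ 0,
      ∑ r : ZMod n → ZMod n with hammingNorm r = m + 1 ∧ r i = 0 ∧ r k ≠ 0 ∧ r k ≠ -v,
        permMean (r + coordVec k v) * starRingEnd ℂ (permMean (r + coordVec i v)) =
      -(2 * (m + 1 : ℕ) * (n - (m + 1 : ℕ)) * Q (m + 1)) := by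
    have : ∀ i k : ZMod n, ∑ v with v ≠ 0,
      ∑ r : ZMod n → ZMod n with hammingNorm r = m + 1 ∧ r i = 0 ∧ r k ≠ 0 ∧ r k ≠ -v,
        permMean (r + coordVec k v) * starRingEnd ℂ (permMean (r + coordVec i v)) =
        -∑ r : ZMod n → ZMod n with hammingNorm r = m + 1,
          if r i = 0 ∧ r k ≠ 0 then 2 * (permMean r * starRingEnd ℂ (permMean r)) else 0 := by
      intro i k
      have h2 : ∀ v : ZMod n,
        ∑ r : ZMod n → ZMod n with hammingNorm r = m + 1 ∧ r i = 0 ∧ r k ≠ 0 ∧ r k ≠ -v,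
        permMean (r + coordVec k v) * starRingEnd ℂ (permMean (r + coordVec i v)) =
        ∑ r : ZMod n → ZMod n with hammingNorm r = m + 1 ∧ r i = 0 ∧ r k ≠ 0 ∧ r k ≠ v,
          permMean r * starRingEnd ℂ (permMean (r - coordVec k v + coordVec i v)) := by
        intro v
        rw [← sum_add_coordVec_of_ne (m + 1) i k v (fun r =>
          permMean r * starRingEnd ℂ (permMean (r - coordVec k v + coordVec i v)))]
        exact sum_congr rfl fun r _ => by rw [add_sub_cancel_right]
      simp_rw [h2]
      have h3 : ∑ v with v ≠ 0,
        ∑ r : ZMod n → ZMod n with hammingNorm r = m + 1 ∧ r i = 0 ∧ r k ≠ 0 ∧ r k ≠ v,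
          permMean r * starRingEnd ℂ (permMean (r - coordVec k v + coordVec i v)) =
        ∑ r : ZMod n → ZMod n with hammingNorm r = m + 1 ∧ r i = 0 ∧ r k ≠ 0,
          ∑ v with v ≠ 0 ∧ r k ≠ v,
          permMean r * starRingEnd ℂ (permMean (r - coordVec k v + coordVec i v)) := by
        refine sum_comm' fun v r => ?_
        simp only [mem_filter, mem_univ, true_and]
        tauto
      rw [h3, ← sum_neg_distrib, ← filter_filter, sum_filter]
      refine sum_congr rfl fun r _ => ?_
      split_ifs with h
      · rw [← mul_sum, ← map_sum, sum_permMean_transfer' r h.1 h.2]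
        simp only [map_neg, map_mul, Complex.conj_ofNat]
        ring
      · simp
    simp_rw [this, sum_neg_distrib]
    rw [neg_inj]
    simp_rw [sum_comm (s := (univ : Finset (ZMod n)))
      (t := univ.filter fun r => hammingNorm r = m + 1)]
    simp only [Q, mul_sum]
    refine sum_congr rfl fun r hr => ?_
    have hc : ∑ i : ZMod n, ∑ k : ZMod n,
        (if r i = 0 ∧ r k ≠ 0 then 2 * (permMean r * starRingEnd ℂ (permMean r)) else 0) =
        ((univ.filter fun i => r i = 0).card : ℂ) * hammingNorm r *
          (2 * (permMean r * starRingEnd ℂ (permMean r))) := by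
      rw [← sum_product', ← sum_filter, sum_const, nsmul_eq_mul, ← Nat.cast_mul, hammingNorm,
        ← card_product]
      congr 3
      ext ⟨a, b⟩
      simp
    have h3 := card_filter_eq_zero r
    have h4 : ((univ.filter fun i => r i = 0).card : ℂ) = n - hammingNorm r := by
      exact_mod_cast congrArg Complex.ofReal h3
    rw [hc, h4, (mem_filter.1 hr).2]
    ring
  have hC : ((n : ℂ) - (m + 1 : ℕ)) * ((m + 2 : ℕ) * Q (m + 2)) =
      ((n : ℂ) - (m + 1 : ℕ)) * ((n - m) * Q m + 2 * (m + 1 : ℕ) * Q (m + 1)) := by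
    have h5 : ((m + 2 : ℕ) * Q (m + 2) : ℂ) = ∑ i : ZMod n, ∑ v with v ≠ 0,
        ∑ r : ZMod n → ZMod n with hammingNorm r = m + 1 ∧ r i = 0,
          permMean (r + coordVec i v) * starRingEnd ℂ (permMean (r + coordVec i v)) := by
      rw [← h1, nsmul_eq_mul]
    rw [h5, mul_sum]
    have h6 : ∀ i : ZMod n, ((n : ℂ) - (m + 1 : ℕ)) * (∑ v with v ≠ 0,
        ∑ r : ZMod n → ZMod n with hammingNorm r = m + 1 ∧ r i = 0,
          permMean (r + coordVec i v) * starRingEnd ℂ (permMean (r + coordVec i v))) =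
        -(∑ k : ZMod n, ∑ v with v ≠ 0,
      ∑ r : ZMod n → ZMod n with hammingNorm r = m + 1 ∧ r i = 0 ∧ r k = -v,
        permMean (r + coordVec k v) * starRingEnd ℂ (permMean (r + coordVec i v)) +
        ∑ k : ZMod n, ∑ v with v ≠ 0,
      ∑ r : ZMod n → ZMod n with hammingNorm r = m + 1 ∧ r i = 0 ∧ r k ≠ 0 ∧ r k ≠ -v,
        permMean (r + coordVec k v) * starRingEnd ℂ (permMean (r + coordVec i v))) := by
      intro i
      rw [sum_comm (s := (univ : Finset (ZMod n))), sum_comm (s := (univ : Finset (ZMod n))),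
        ← sum_add_distrib, mul_sum, ← sum_neg_distrib]
      refine sum_congr rfl fun v hv => ?_
      have hv := (mem_filter.1 hv).2
      rw [sum_support_split (m + 1) i hv (fun k r =>
        permMean (r + coordVec k v) * starRingEnd ℂ (permMean (r + coordVec i v))), mul_sum,
        ← sum_neg_distrib]
      refine sum_congr rfl fun r hr => ?_
      have hr := (mem_filter.1 hr).2
      have h7 := permMean_recursion r hr.2 hv
      rw [hr.1] at h7
      rw [← mul_assoc, h7, ← sum_mul, neg_mul]
    rw [sum_congr rfl fun i _ => h6 i, sum_neg_distrib, sum_add_distrib, hA, hB]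
    ring
  have hD := mul_left_cancel₀ hn hC
  rw [hQ, hQ, hQ] at hD
  have : (((m : ℝ) + 2) * secondMoment n (m + 2) : ℝ) =
      ((n - m) * secondMoment n m + 2 * (m + 1) * secondMoment n (m + 1) : ℝ) := by
    apply Complex.ofReal_injective
    push_cast at hD ⊢
    exact hD
  exact this

theorem secondMoment_nonneg (m : ℕ) : 0 ≤ secondMoment n m :=
  sum_nonneg fun _ _ => by positivity

/-- On average over the vectors with `m` nonzero coordinates, the bound is much smaller than what
Parseval's identity on `m` coordinates gives: up to the factor `3 ^ m` it is the square root of the latter. -/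
theorem secondMoment_le (m : ℕ) : secondMoment n m ≤ 3 ^ m * √((n : ℝ) ^ m / m !) := by
  induction m using Nat.twoStepInduction with
  | zero => simp [secondMoment_zero]
  | one =>
    rw [secondMoment_one]
    positivity
  | more m h1 h2 =>
    rcases lt_or_ge n (m + 2) with hn | hn
    · rw [secondMoment_of_lt hn]
      positivity
    have hrec := secondMoment_recursion hn
    have hn0 : (0 : ℝ) < n := by exact_mod_cast (by omega : 0 < n)
    have hn' : (m : ℝ) + 2 ≤ n := by exact_mod_cast hn
    set u : ℕ → ℝ := fun m => √((n : ℝ) ^ m / m !) with hu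
    have hu1 : (n : ℝ) * u m ≤ (m + 2) * u (m + 2) := by
      refine le_of_sq_le_sq ?_ (by positivity)
      rw [mul_pow, mul_pow, hu]
      simp only
      rw [Real.sq_sqrt (by positivity), Real.sq_sqrt (by positivity), Nat.factorial_succ,
        Nat.factorial_succ]
      push_cast
      have : ((m : ℝ) + 2) ^ 2 * (n ^ (m + 2) / ((m + 1 + 1) * ((m + 1) * m !))) =
          n ^ 2 * (n ^ m / m !) * ((m + 2) / (m + 1)) := by
        field_simp
        ring
      rw [this]
      exact le_mul_of_one_le_right (by positivity) ((one_le_div (by positivity)).2 (by linarith))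
    have hu2 : u (m + 1) ≤ u (m + 2) := by
      refine Real.sqrt_le_sqrt ?_
      rw [Nat.factorial_succ (m + 1), div_le_div_iff₀ (by positivity) (by positivity)]
      push_cast
      rw [pow_succ (n : ℝ) (m + 1)]
      have : (0 : ℝ) ≤ n ^ (m + 1) * (m + 1)! := by positivity
      nlinarith
    have h3 : (n - m) * secondMoment n m ≤ 3 ^ m * ((m + 2) * u (m + 2)) := by
      calc (n - m) * secondMoment n m ≤ n * (3 ^ m * u m) :=
            mul_le_mul (by linarith [(Nat.cast_nonneg m : (0 : ℝ) ≤ m)]) h1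
              (secondMoment_nonneg m) hn0.le
        _ = 3 ^ m * (n * u m) := by ring
        _ ≤ _ := by gcongr
    have h4 : 2 * ((m : ℝ) + 1) * secondMoment n (m + 1) ≤ 6 * (3 ^ m * ((m + 2) * u (m + 2))) := by
      calc 2 * ((m : ℝ) + 1) * secondMoment n (m + 1)
          ≤ 2 * ((m : ℝ) + 2) * (3 ^ (m + 1) * u (m + 2)) := by
            gcongr
            · exact secondMoment_nonneg _
            · norm_num
            · exact h2.trans (by gcongr)
        _ = _ := by ring
    have h5 : ((m : ℝ) + 2) * secondMoment n (m + 2) ≤ (m + 2) * (3 ^ (m + 2) * u (m + 2)) := by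
      rw [hrec]
      calc _ ≤ 7 * (3 ^ m * ((m + 2) * u (m + 2))) := by linarith
        _ ≤ 9 * (3 ^ m * ((m + 2) * u (m + 2))) := by
            gcongr
            norm_num
        _ = _ := by ring
    exact le_of_mul_le_mul_left h5 (by positivity)

end

/-! ### Vectors with given multiplicities -/

/-- The number of coordinates at which `r` takes the value `a`. -/
def mult {ι α : Type*} [Fintype ι] [DecidableEq α] (r : ι → α) (a : α) : ℕ :=
  (univ.filter fun i => r i = a).card

section

variable {ι α : Type*} [Fintype ι] [DecidableEq α]

theorem mult_le_card (r : ι → α) (a : α) : mult r a ≤ Fintype.card ι := card_le_univ _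

theorem mult_comp_perm (r : ι → α) (u : Equiv.Perm ι) : mult (r ∘ u) = mult r := by
  ext a
  exact card_bij (fun i _ => u i) (fun i hi => by simpa using hi) (fun _ _ _ _ h => u.injective h)
    fun i hi => ⟨u.symm i, by simpa using hi⟩

theorem exists_perm_of_mult_eq {r t : ι → α} (h : mult t = mult r) :
    ∃ u : Equiv.Perm ι, r ∘ u = t := by
  have e : ∀ a, Nonempty ({i // t i = a} ≃ {i // r i = a}) := fun a => by
    refine ⟨Fintype.equivOfCardEq ?_⟩
    rw [Fintype.card_subtype, Fintype.card_subtype]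
    exact congrFun h a
  refine ⟨Equiv.ofFiberEquiv fun a => (e a).some, ?_⟩
  ext i
  exact Equiv.ofFiberEquiv_map _ i

variable [Fintype α]

theorem sum_mult (r : ι → α) : ∑ a, mult r a = Fintype.card ι :=
  (card_eq_sum_card_fiberwise (fun _ _ => mem_coe.2 (mem_univ _))).symm

theorem prod_comp_mult {M : Type*} [CommMonoid M] (r : ι → α) (f : α → M) :
    ∏ i, f (r i) = ∏ a, f a ^ mult r a := by
  rw [← prod_fiberwise univ r]
  refine prod_congr rfl fun a _ => ?_
  rw [prod_congr rfl (fun i hi => by rw [(mem_filter.1 hi).2]), prod_const]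
  rfl

variable [DecidableEq ι]

/-- The number of permutations carrying `r` to a vector `t` with the same multiplicities is the
order of the stabilizer of `r`. -/
theorem card_perm_comp_eq (r t : ι → α) :
    (univ.filter fun p : Equiv.Perm ι => r ∘ p = t).card =
      if mult t = mult r then ∏ a, (mult r a)! else 0 := by
  split_ifs with h
  · obtain ⟨u, rfl⟩ := exists_perm_of_mult_eq h
    have h1 := DomMulAct.stabilizer_card r
    simp only [Fintype.card_subtype] at h1
    refine Eq.trans ?_ h1
    refine card_nbij' (fun p => p * u⁻¹) (fun p => p * u) ?_ ?_ ?_ ?_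
    · intro p hp
      simp only [mem_univ, true_and, coe_filter, Set.mem_ofPred_eq] at hp ⊢
      ext i
      simpa using congrFun hp (u⁻¹ i)
    · intro p hp
      simp only [mem_univ, true_and, coe_filter, Set.mem_ofPred_eq] at hp ⊢
      ext i
      simpa using congrFun hp (u i)
    · intro p _; simp
    · intro p _; simp
  · rw [card_eq_zero, filter_eq_empty_iff]
    rintro p - rfl
    exact h (mult_comp_perm r p)

theorem sum_perm_comp (r : ι → α) (h : (ι → α) → ℂ) :
    ∑ p : Equiv.Perm ι, h (r ∘ p) =
      (∏ a, (mult r a)! : ℕ) * ∑ t with mult t = mult r, h t := by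
  rw [← sum_fiberwise univ (fun p : Equiv.Perm ι => r ∘ p), mul_sum, sum_filter]
  refine sum_congr rfl fun t _ => ?_
  rw [sum_congr rfl (fun p hp => by rw [(mem_filter.1 hp).2]), sum_const, card_perm_comp_eq,
    nsmul_eq_mul]
  split_ifs <;> simp

theorem card_mult_eq (r : ι → α) :
    (univ.filter fun t : ι → α => mult t = mult r).card * ∏ a, (mult r a)! =
      (Fintype.card ι)! := by
  have h := sum_perm_comp r (fun _ => 1)
  simp only [sum_const, card_univ, Fintype.card_perm, nsmul_eq_mul, mul_one] at h
  rw [mul_comm]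
  exact_mod_cast h.symm

end

/-! ### The entropy bound -/

theorem prod_le_mean_pow {ι : Type*} [Fintype ι] [Nonempty ι] (z : ι → ℝ) (hz : ∀ i, 0 ≤ z i) :
    ∏ i, z i ≤ ((∑ i, z i) / Fintype.card ι) ^ Fintype.card ι := by
  have hc : (0 : ℝ) < Fintype.card ι := by exact_mod_cast Fintype.card_pos
  have h := Real.geom_mean_le_arith_mean_weighted univ (fun _ : ι => (Fintype.card ι : ℝ)⁻¹) z
    (fun _ _ => by positivity) (by simp [hc.ne']) (fun i _ => hz i)
  rw [Real.finsetProd_rpow _ _ (fun i _ => hz i), ← mul_sum] at h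
  have h2 := pow_le_pow_left₀ (by have := prod_nonneg (fun i (_ : i ∈ univ) => hz i); positivity) h
    (Fintype.card ι)
  rwa [← Real.rpow_natCast, ← Real.rpow_mul (prod_nonneg fun i _ => hz i), inv_mul_cancel₀ hc.ne',
    Real.rpow_one, inv_mul_eq_div] at h2

section

variable {n : ℕ} [NeZero n]

theorem sum_norm_sq_dft (x : ZMod n → ℂ) :
    ∑ g : ZMod n, ‖∑ a, x a * ZMod.stdAddChar (a * g)‖ ^ 2 = n * ∑ a, ‖x a‖ ^ 2 := by
  apply Complex.ofReal_injective
  push_cast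
  simp_rw [← Complex.mul_conj', map_sum, sum_mul_sum]
  rw [sum_comm]
  rw [mul_sum]
  refine sum_congr rfl fun a _ => ?_
  rw [sum_comm]
  have : ∀ b : ZMod n, ∑ g : ZMod n, x a * ZMod.stdAddChar (a * g) *
      starRingEnd ℂ (x b * ZMod.stdAddChar (b * g)) =
      if a = b then n * (x a * starRingEnd ℂ (x b)) else 0 := by
    intro b
    have h1 : ∀ g : ZMod n, x a * ZMod.stdAddChar (a * g) *
        starRingEnd ℂ (x b * ZMod.stdAddChar (b * g)) =
        x a * starRingEnd ℂ (x b) * ZMod.stdAddChar (g * (a - b)) := fun g => by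
      rw [map_mul (starRingEnd ℂ), ← AddChar.map_neg_eq_conj, mul_mul_mul_comm, ← AddChar.map_add_eq_mul]
      congr 2
      ring
    simp_rw [h1, ← mul_sum, sum_stdAddChar_mul, sub_eq_zero]
    split_ifs <;> ring
  simp_rw [this]
  simp

/-- The exponential sum over all rearrangements of `r`. It is the coefficient of the monomial with
exponents `mult r` in the determinant of the generic circulant matrix of order `n`. -/
noncomputable def rearrangementSum (r : ZMod n → ZMod n) : ℂ :=
  ∑ t : ZMod n → ZMod n with mult t = mult r, ZMod.stdAddChar (∑ i, t i * i)

theorem factorial_mul_permMean (r : ZMod n → ZMod n) :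
    (n ! : ℂ) * permMean r = (∏ a, (mult r a)! : ℕ) * rearrangementSum r := by
  rw [permMean, mul_inv_cancel_left₀ (factorial_ne_zero_complex n), rearrangementSum,
    ← sum_perm_comp r (fun t => (ZMod.stdAddChar (∑ i, t i * i) : ℂ))]
  refine Fintype.sum_equiv (Equiv.inv _) _ _ fun p => ?_
  congr 1
  exact Fintype.sum_equiv p _ _ fun i => by simp

/-- A coefficient bound for the circulant determinant `∏ g, ∑ a, x a * e(a g / n)`: its absolute
value is at most `n ^ (n / 2)` where `|x a| ^ 2 = mult r a`, by the inequality between the geometric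
and the quadratic mean and by Parseval, and a coefficient is extracted by averaging over the phases
of the `x a`, which may be taken to be roots of unity of order `n + 1`. -/
theorem norm_rearrangementSum_sq_le (r : ZMod n → ZMod n) :
    ‖rearrangementSum r‖ ^ 2 * (∏ a, (mult r a) ^ (mult r a) : ℕ) ≤ (n : ℝ) ^ n := by
  let e : AddChar (ZMod (n + 1)) ℂ := ZMod.stdAddChar
  let w : ZMod n → ℝ := fun a => √(mult r a)
  let P : (ZMod n → ZMod (n + 1)) → ℂ := fun θ =>
    ∏ g, ∑ a, (w a * e (θ a)) * ZMod.stdAddChar (a * g)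
  have hP : ∀ θ, ‖P θ‖ ^ 2 ≤ (n : ℝ) ^ n := fun θ => by
    have h := prod_le_mean_pow (fun g : ZMod n =>
      ‖∑ a, (w a * e (θ a)) * ZMod.stdAddChar (a * g)‖ ^ 2) (fun _ => by positivity)
    rw [sum_norm_sq_dft] at h
    have h2 : ∑ a, ‖(w a * e (θ a) : ℂ)‖ ^ 2 = n := by
      have : ∀ a, ‖(w a * e (θ a) : ℂ)‖ ^ 2 = mult r a := fun a => by
        rw [norm_mul, AddChar.norm_apply, mul_one, Complex.norm_real, Real.norm_eq_abs, sq_abs,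
          Real.sq_sqrt (by positivity)]
      simp_rw [this]
      rw [← Nat.cast_sum, sum_mult, ZMod.card]
    rw [h2, ZMod.card, mul_div_assoc, div_self (by exact_mod_cast NeZero.ne n), mul_one,
      prod_pow, ← norm_prod] at h
    exact h
  have hexp : ∀ θ, P θ = ∑ t : ZMod n → ZMod n, (∏ g, (w (t g) : ℂ)) *
      e (∑ a, θ a * mult t a) * ZMod.stdAddChar (∑ i, t i * i) := fun θ => by
    simp only [P]
    rw [prod_univ_sum, Fintype.piFinset_univ]
    refine sum_congr rfl fun t _ => ?_
    rw [prod_mul_distrib, prod_mul_distrib, addChar_sum, addChar_sum]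
    congr 2
    rw [prod_comp_mult t (fun a => e (θ a))]
    refine prod_congr rfl fun a _ => ?_
    rw [mul_comm, ← nsmul_eq_mul, AddChar.map_nsmul_eq_pow]
  have horth : ∀ t : ZMod n → ZMod n, ∑ θ : ZMod n → ZMod (n + 1),
      e (∑ a, θ a * mult t a) * e (-∑ a, θ a * mult r a) =
      if mult t = mult r then ((n : ℂ) + 1) ^ n else 0 := fun t => by
    have h1 : ∀ θ : ZMod n → ZMod (n + 1), e (∑ a, θ a * mult t a) * e (-∑ a, θ a * mult r a) =
        ∏ a, e (θ a * ((mult t a : ZMod (n + 1)) - mult r a)) := fun θ => by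
      rw [← AddChar.map_add_eq_mul, ← addChar_sum]
      congr 1
      simp_rw [mul_sub]
      rw [sum_sub_distrib, sub_eq_add_neg]
    simp_rw [h1]
    have h2 := prod_univ_sum (fun _ : ZMod n => (univ : Finset (ZMod (n + 1))))
      (fun a v => e (v * ((mult t a : ZMod (n + 1)) - mult r a)))
    rw [Fintype.piFinset_univ] at h2
    rw [← h2]
    simp only [e]
    simp_rw [sum_stdAddChar_mul]
    split_ifs with h
    · simp [h, ZMod.card]
    · obtain ⟨a, ha⟩ := Function.ne_iff.1 h
      refine prod_eq_zero (mem_univ a) (if_neg ?_)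
      rw [sub_eq_zero]
      intro h3
      have h4 := (ZMod.natCast_eq_natCast_iff' _ _ _).1 h3
      have hb : ∀ u : ZMod n → ZMod n, mult u a < n + 1 := fun u => by
        have := mult_le_card u a
        rw [ZMod.card] at this
        omega
      rw [Nat.mod_eq_of_lt (hb t), Nat.mod_eq_of_lt (hb r)] at h4
      exact ha h4
  have hw : ∀ t : ZMod n → ZMod n, mult t = mult r →
      ∏ g, (w (t g) : ℂ) = (√(∏ a, (mult r a) ^ (mult r a) : ℕ) : ℝ) := fun t ht => by
    rw [prod_comp_mult t (fun a => (w a : ℂ)), ht]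
    push_cast
    rw [Real.sqrt_prod _ (fun _ _ => by positivity)]
    push_cast
    refine prod_congr rfl fun a _ => ?_
    rw [Real.sqrt_eq_rpow, ← Real.rpow_natCast, ← Real.rpow_mul (by positivity), mul_comm,
      Real.rpow_mul (by positivity), ← Real.sqrt_eq_rpow, Real.rpow_natCast]
    push_cast
    rfl
  have havg : ∑ θ : ZMod n → ZMod (n + 1), e (-∑ a, θ a * mult r a) * P θ =
      ((n : ℂ) + 1) ^ n * ((√(∏ a, (mult r a) ^ (mult r a) : ℕ) : ℝ) * rearrangementSum r) := by
    simp_rw [hexp, mul_sum]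
    rw [sum_comm, rearrangementSum, mul_sum, mul_sum, sum_filter]
    refine sum_congr rfl fun t _ => ?_
    have : ∀ θ : ZMod n → ZMod (n + 1), e (-∑ a, θ a * mult r a) * ((∏ g, (w (t g) : ℂ)) *
        e (∑ a, θ a * mult t a) * ZMod.stdAddChar (∑ i, t i * i)) =
        (∏ g, (w (t g) : ℂ)) * ZMod.stdAddChar (∑ i, t i * i) *
        (e (∑ a, θ a * mult t a) * e (-∑ a, θ a * mult r a)) := fun θ => by ring
    simp_rw [this, ← mul_sum, horth]
    split_ifs with h
    · rw [hw t h]; ring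
    · ring
  have hle : ((n : ℝ) + 1) ^ n * (√(∏ a, (mult r a) ^ (mult r a) : ℕ) * ‖rearrangementSum r‖) ≤
      ((n : ℝ) + 1) ^ n * √((n : ℝ) ^ n) := by
    have h1 := congrArg norm havg
    have h2 : ‖∑ θ : ZMod n → ZMod (n + 1), e (-∑ a, θ a * mult r a) * P θ‖ ≤ ∑ θ : ZMod n → ZMod (n + 1), √((n : ℝ) ^ n) := by
      refine norm_sum_le_of_le _ fun θ _ => ?_
      rw [norm_mul, AddChar.norm_apply, one_mul]
      exact Real.le_sqrt_of_sq_le (hP θ)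
    rw [h1, norm_mul, norm_mul, norm_pow, Complex.norm_real, Real.norm_of_nonneg (Real.sqrt_nonneg _)] at h2
    have h3 : ‖(n : ℂ) + 1‖ = n + 1 := by exact_mod_cast Complex.norm_natCast (n + 1)
    rw [h3] at h2
    simpa [ZMod.card] using h2
  have h4 := le_of_mul_le_mul_left hle (by positivity)
  have h5 := pow_le_pow_left₀ (by positivity) h4 2
  rw [mul_pow, Real.sq_sqrt (Nat.cast_nonneg _), Real.sq_sqrt (by positivity), mul_comm] at h5
  exact h5

/-- Square-root cancellation: up to the corrections in Stirling's formula, `permMean r` is at most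
the inverse square root of the number `n! / ∏ a, (mult r a)!` of rearrangements of `r`. -/
theorem norm_permMean_sq_le (r : ZMod n → ZMod n) :
    ‖permMean r‖ ^ 2 ≤ ((∏ a, (mult r a)! : ℕ) : ℝ) ^ 2 * n ^ n /
      ((n ! : ℝ) ^ 2 * (∏ a, (mult r a) ^ (mult r a) : ℕ)) := by
  have hQ : (0 : ℝ) < (∏ a, (mult r a) ^ (mult r a) : ℕ) := by
    have : 0 < ∏ a, (mult r a) ^ (mult r a) := prod_pos fun a _ => Nat.pow_self_pos
    exact_mod_cast this
  have h := congrArg (fun z => ‖z‖ ^ 2) (factorial_mul_permMean r)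
  simp only [norm_mul, Complex.norm_natCast, mul_pow] at h
  rw [le_div_iff₀ (by positivity)]
  calc _ = ((n ! : ℝ) ^ 2 * ‖permMean r‖ ^ 2) * (∏ a, (mult r a) ^ (mult r a) : ℕ) := by ring
    _ = ((∏ a, (mult r a)! : ℕ) : ℝ) ^ 2 *
        (‖rearrangementSum r‖ ^ 2 * (∏ a, (mult r a) ^ (mult r a) : ℕ)) := by rw [h]; ring
    _ ≤ _ := by gcongr; exact norm_rearrangementSum_sq_le r

end

/-! ### Counting multiplicity functions -/

theorem card_piAntidiag_eq {α : Type*} [DecidableEq α] (T : Finset α) (m : ℕ) :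
    (T.piAntidiag m).card = T.card.multichoose m := by
  rw [← card_finsuppAntidiag_nat_eq_multichoose]
  simp [finsuppAntidiag]

theorem card_sum_eq_support_le {α : Type*} [Fintype α] [DecidableEq α] (m k : ℕ)
    (hk : k ≤ Fintype.card α) (𝒯 : Finset (α → ℕ))
    (h : ∀ a ∈ 𝒯, ∑ x, a x = m ∧ (univ.filter fun x => a x ≠ 0).card ≤ k) :
    𝒯.card ≤ (Fintype.card α).choose k * k.multichoose m := by
  have hsub : 𝒯 ⊆ (powersetCard k univ).biUnion fun T => T.piAntidiag m := fun a ha => by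
    obtain ⟨T, hT, -, hTk⟩ := exists_subsuperset_card_eq (subset_univ _) (h a ha).2
      (by rwa [card_univ])
    refine mem_biUnion.2 ⟨T, mem_powersetCard.2 ⟨subset_univ _, hTk⟩, mem_piAntidiag.2 ⟨?_, ?_⟩⟩
    · rw [← (h a ha).1]
      refine sum_subset (subset_univ _) fun x _ hx => ?_
      by_contra h0
      exact hx (hT (by simpa using h0))
    · intro x hx
      exact hT (by simpa using hx)
  calc 𝒯.card ≤ _ := card_le_card hsub
    _ ≤ (powersetCard k (univ : Finset α)).card * k.multichoose m := by
        refine card_biUnion_le_card_mul _ _ _ fun T hT => ?_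
        rw [card_piAntidiag_eq, (mem_powersetCard.1 hT).2]
    _ = _ := by rw [card_powersetCard, card_univ]

/-- If a nonnegative function contributes at most `B` per class of a partition, its sum is at most
`B` times the number of classes. -/
theorem sum_le_card_mul_of_fiber {V β : Type*} [DecidableEq β] (R : Finset V) (f : V → ℝ)
    (τ : V → β) (B : ℝ)
    (h : ∀ r ∈ R, ((R.filter fun t => τ t = τ r).card : ℝ) * f r ≤ B) :
    ∑ r ∈ R, f r ≤ (R.image τ).card * B := by
  rw [← sum_fiberwise_of_maps_to (fun r hr => mem_image_of_mem τ hr) f, ← nsmul_eq_mul]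
  refine sum_le_card_nsmul _ _ _ fun b hb => ?_
  obtain ⟨r, hr, rfl⟩ := mem_image.1 hb
  have hpos : (0 : ℝ) < (R.filter fun t => τ t = τ r).card := by
    exact_mod_cast card_pos.2 ⟨r, by simp [hr]⟩
  calc ∑ i ∈ R with τ i = τ r, f i ≤
        (R.filter fun t => τ t = τ r).card • (B / (R.filter fun t => τ t = τ r).card) := by
        refine sum_le_card_nsmul _ _ _ fun i hi => ?_
        have hi := mem_filter.1 hi
        rw [le_div_iff₀ hpos, mul_comm]
        have := h i hi.1
        rwa [hi.2] at this
    _ = B := by rw [nsmul_eq_mul]; field_simp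

theorem factorial_succ_mul_factorial_succ_le (c m : ℕ) : (c + 1)! * (m + 1)! ≤ (c + 1 + m)! := by
  induction c with
  | zero => simp [add_comm]
  | succ c ih =>
    rw [Nat.factorial_succ (c + 1), show c + 1 + 1 + m = c + 1 + m + 1 by ring,
      Nat.factorial_succ (c + 1 + m), mul_assoc]
    exact Nat.mul_le_mul (by omega) ih

/-- A multiset of multiplicities with `t` positive entries has at least `t!` arrangements. -/
theorem factorial_card_mul_prod_le {α : Type*} [DecidableEq α] (T : Finset α) (a : α → ℕ)
    (h : ∀ x ∈ T, a x ≠ 0) : T.card ! * ∏ x ∈ T, (a x)! ≤ (∑ x ∈ T, a x)! := by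
  have hcard : ∀ T : Finset α, (∀ x ∈ T, a x ≠ 0) → T.card ≤ ∑ x ∈ T, a x := fun T h => by
    rw [card_eq_sum_ones]
    exact sum_le_sum fun x hx => Nat.one_le_iff_ne_zero.2 (h x hx)
  induction T using Finset.induction_on with
  | empty => simp
  | insert b T hb ih =>
    have h' : ∀ x ∈ T, a x ≠ 0 := fun x hx => h x (mem_insert_of_mem hx)
    have hb0 : a b ≠ 0 := h b (mem_insert_self _ _)
    rw [card_insert_of_notMem hb, prod_insert hb, sum_insert hb, Nat.factorial_succ]
    set S := ∑ x ∈ T, a x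
    calc (T.card + 1) * T.card ! * ((a b)! * ∏ x ∈ T, (a x)!)
        = (T.card + 1) * ((a b)! * (T.card ! * ∏ x ∈ T, (a x)!)) := by ring
      _ ≤ (S + 1) * ((a b)! * S !) := by
          gcongr
          · exact hcard T h'
          · exact ih h'
      _ = (a b)! * (S + 1)! := by rw [Nat.factorial_succ]; ring
      _ ≤ (a b + S)! := by
          obtain ⟨c, hc⟩ := Nat.exists_eq_succ_of_ne_zero hb0
          rw [hc]
          exact factorial_succ_mul_factorial_succ_le c S

theorem factorial_mul_exp_le {a : ℕ} (ha : a ≠ 0) :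
    (a ! : ℝ) * Real.exp a ≤ Real.exp 1 * a * (a : ℝ) ^ a := by
  induction a, Nat.one_le_iff_ne_zero.2 ha using Nat.le_induction with
  | base => simp
  | succ a h1 ih =>
    have ih := ih (by omega)
    have ha0 : (0 : ℝ) < a := by exact_mod_cast h1
    have h2 : (a : ℝ) / (a + 1) ≤ Real.exp (-(1 / (a + 1))) := by
      have h := Real.add_one_le_exp (-(1 / ((a : ℝ) + 1)))
      refine le_trans (le_of_eq ?_) h
      field_simp
      ring
    have h3 : (a / (a + 1) : ℝ) ^ (a + 1) ≤ Real.exp (-1) := by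
      refine (pow_le_pow_left₀ (by positivity) h2 _).trans (le_of_eq ?_)
      rw [← Real.exp_nat_mul]
      congr 1
      push_cast
      field_simp
    rw [div_pow, div_le_iff₀ (by positivity), Real.exp_neg, inv_mul_eq_div,
      le_div_iff₀ (Real.exp_pos 1)] at h3
    rw [Nat.factorial_succ]
    push_cast
    rw [Real.exp_add]
    calc ((a : ℝ) + 1) * a ! * (Real.exp a * Real.exp 1)
        = (a + 1) * Real.exp 1 * (a ! * Real.exp a) := by ring
      _ ≤ (a + 1) * Real.exp 1 * (Real.exp 1 * a * (a : ℝ) ^ a) := by gcongr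
      _ = (a + 1) * Real.exp 1 * ((a : ℝ) ^ (a + 1) * Real.exp 1) := by ring
      _ ≤ (a + 1) * Real.exp 1 * ((a : ℝ) + 1) ^ (a + 1) := by gcongr
      _ = _ := by ring

/-! ### Vectors of small support -/

section

variable {n : ℕ} [NeZero n]

theorem mult_zero_eq (r : ZMod n → ZMod n) : mult r 0 = n - hammingNorm r := by
  have := card_filter_add_card_filter_not (s := (univ : Finset (ZMod n))) (fun k => r k = 0)
  rw [card_univ, ZMod.card] at this
  simp only [mult, hammingNorm, ne_eq]
  omega

theorem hammingNorm_le (r : ZMod n → ZMod n) : hammingNorm r ≤ n := by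
  have h2 : hammingNorm r ≤ Fintype.card (ZMod n) := hammingNorm_le_card_fintype
  rwa [ZMod.card] at h2

theorem sum_mult_erase (r : ZMod n → ZMod n) : ∑ a ∈ univ.erase 0, mult r a = hammingNorm r := by
  have h := sum_mult r
  rw [ZMod.card, ← add_sum_erase _ _ (mem_univ 0), mult_zero_eq] at h
  have := hammingNorm_le r
  omega

/-- The product of the factorials of the multiplicities of the nonzero values of `r`. -/
def nonzeroFactorial (r : ZMod n → ZMod n) : ℕ := ∏ a ∈ univ.erase 0, (mult r a)!

/-- The number of distinct nonzero values of `r`. -/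
def nonzeroValues (r : ZMod n → ZMod n) : ℕ := ((univ.erase 0).filter fun a => mult r a ≠ 0).card

theorem nonzeroFactorial_pos (r : ZMod n → ZMod n) : 0 < nonzeroFactorial r :=
  prod_pos fun _ _ => Nat.factorial_pos _

theorem prod_factorial_mult (r : ZMod n → ZMod n) :
    ∏ a, (mult r a)! = (n - hammingNorm r)! * nonzeroFactorial r := by
  rw [← mul_prod_erase _ _ (mem_univ 0), mult_zero_eq, nonzeroFactorial]

theorem factorial_nonzeroValues_mul_le (r : ZMod n → ZMod n) :
    (nonzeroValues r)! * nonzeroFactorial r ≤ (hammingNorm r)! := by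
  have h := factorial_card_mul_prod_le ((univ.erase 0).filter fun a => mult r a ≠ 0) (mult r)
    fun a ha => (mem_filter.1 ha).2
  have h1 : ∏ a ∈ (univ.erase 0).filter (fun a => mult r a ≠ 0), (mult r a)! = nonzeroFactorial r :=
    prod_filter_of_ne fun a _ h h0 => h (by rw [h0]; rfl)
  have h2 : ∑ a ∈ (univ.erase 0).filter (fun a => mult r a ≠ 0), mult r a = hammingNorm r := by
    rw [← sum_mult_erase]
    exact sum_filter_of_ne fun a _ h => h
  rwa [h1, h2] at h

theorem factorial_div_le {n m : ℕ} (hm : 2 * m ≤ n) :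
    ((n - m)! : ℝ) * n ^ m ≤ 2 ^ m * n ! := by
  have h1 : (n - m)! * n.descFactorial m = n ! := Nat.factorial_mul_descFactorial (by omega)
  have h2 : (n + 1 - m) ^ m ≤ n.descFactorial m := Nat.pow_sub_le_descFactorial n m
  have h3 : n ^ m ≤ 2 ^ m * n.descFactorial m := by
    calc n ^ m ≤ (2 * (n + 1 - m)) ^ m := Nat.pow_le_pow_left (by omega) m
      _ = 2 ^ m * (n + 1 - m) ^ m := by rw [mul_pow]
      _ ≤ _ := by gcongr
  have h4 : (n - m)! * n ^ m ≤ 2 ^ m * n ! := by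
    rw [← h1]
    calc (n - m)! * n ^ m ≤ (n - m)! * (2 ^ m * n.descFactorial m) := by gcongr
      _ = _ := by ring
  exact_mod_cast h4

theorem pow_self_le {m : ℕ} (hm : 2 * m ≤ n) :
    (n : ℝ) ^ n ≤ 3 ^ m * n ^ m * ((n - m : ℕ) : ℝ) ^ (n - m) := by
  have hn : (0 : ℝ) < n := by exact_mod_cast NeZero.pos n
  have hk : 0 < n - m := by have := NeZero.pos n; omega
  have hk' : (0 : ℝ) < ((n - m : ℕ) : ℝ) := by exact_mod_cast hk
  have h1 : (n : ℝ) = (n - m : ℕ) + m := by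
    rw [← Nat.cast_add]
    congr 1
    omega
  have h2 : ((n : ℝ) / (n - m : ℕ)) ^ (n - m) ≤ 3 ^ m := by
    have h3 : (n : ℝ) / (n - m : ℕ) ≤ Real.exp (m / (n - m : ℕ)) := by
      refine le_trans (le_of_eq ?_) (Real.add_one_le_exp _)
      conv_lhs => rw [h1]
      field_simp
      ring
    calc ((n : ℝ) / (n - m : ℕ)) ^ (n - m) ≤ Real.exp (m / (n - m : ℕ)) ^ (n - m) := by gcongr
      _ = Real.exp 1 ^ m := by
          rw [← Real.exp_nat_mul, ← Real.exp_nat_mul, mul_div_cancel₀ _ hk'.ne', mul_one]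
      _ ≤ 3 ^ m := by
          gcongr
          exact Real.exp_one_lt_three.le
  rw [div_pow, div_le_iff₀ (by positivity)] at h2
  calc (n : ℝ) ^ n = n ^ m * n ^ (n - m) := by
        rw [← pow_add]
        congr 1
        omega
    _ ≤ n ^ m * (3 ^ m * ((n - m : ℕ) : ℝ) ^ (n - m)) := by gcongr
    _ = _ := by ring

/-- The entropy bound for vectors with few nonzero coordinates. -/
theorem norm_permMean_sq_le_of_hammingNorm (r : ZMod n → ZMod n) {m : ℕ} (hr : hammingNorm r = m)
    (hm : 2 * m ≤ n) : ‖permMean r‖ ^ 2 ≤ 12 ^ m * nonzeroFactorial r / (n : ℝ) ^ m := by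
  have hn : (0 : ℝ) < n := by exact_mod_cast NeZero.pos n
  refine (norm_permMean_sq_le r).trans ?_
  have hk : 0 < n - m := by have := NeZero.pos n; omega
  have hk' : (0 : ℝ) < ((n - m : ℕ) : ℝ) := by exact_mod_cast hk
  have hw : (0 : ℝ) < nonzeroFactorial r := by exact_mod_cast nonzeroFactorial_pos r
  have hQ : (nonzeroFactorial r : ℝ) * ((n - m : ℕ) : ℝ) ^ (n - m) ≤
      (∏ a, (mult r a) ^ (mult r a) : ℕ) := by
    have : nonzeroFactorial r * (n - m) ^ (n - m) ≤ ∏ a, (mult r a) ^ (mult r a) := by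
      rw [← mul_prod_erase _ _ (mem_univ 0), mult_zero_eq, hr, mul_comm]
      gcongr
      exact prod_le_prod' fun a _ => Nat.factorial_le_pow _
    exact_mod_cast this
  have h2 := factorial_div_le hm
  have h3 := pow_self_le hm
  have hQ0 : (0 : ℝ) < (∏ a, (mult r a) ^ (mult r a) : ℕ) := lt_of_lt_of_le (by positivity) hQ
  have h12 : (12 : ℝ) ^ m = 3 ^ m * (2 ^ m) ^ 2 := by
    rw [← pow_mul, mul_comm m 2, pow_mul, ← mul_pow]
    norm_num
  rw [prod_factorial_mult, hr, div_le_div_iff₀ (by positivity) (by positivity)]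
  push_cast at hQ ⊢
  calc (((n - m)! : ℝ) * nonzeroFactorial r) ^ 2 * n ^ n * n ^ m
      ≤ (((n - m)! : ℝ) * nonzeroFactorial r) ^ 2 *
        (3 ^ m * n ^ m * ((n - m : ℕ) : ℝ) ^ (n - m)) * n ^ m := by gcongr
    _ = 3 ^ m * nonzeroFactorial r * ((n - m)! * n ^ m) ^ 2 *
        (nonzeroFactorial r * ((n - m : ℕ) : ℝ) ^ (n - m)) := by ring
    _ ≤ 3 ^ m * nonzeroFactorial r * (2 ^ m * n !) ^ 2 *
        (∏ a, (mult r a : ℝ) ^ (mult r a)) := by gcongr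
    _ = 12 ^ m * nonzeroFactorial r * ((n ! : ℝ) ^ 2 * ∏ a, (mult r a : ℝ) ^ (mult r a)) := by
        rw [h12]
        ring

/-- The sum of `‖permMean r‖ ^ 3` over the vectors `r` with exactly `m` nonzero coordinates. -/
noncomputable def absThirdMoment (n m : ℕ) [NeZero n] : ℝ :=
  ∑ r : ZMod n → ZMod n with hammingNorm r = m, ‖permMean r‖ ^ 3

theorem sum_norm_cube_le {R : Finset (ZMod n → ZMod n)} {m : ℕ} {B : ℝ}
    (hR : ∀ r ∈ R, hammingNorm r = m) (hB : ∀ r ∈ R, ‖permMean r‖ ≤ B) (hB0 : 0 ≤ B) :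
    ∑ r ∈ R, ‖permMean r‖ ^ 3 ≤ secondMoment n m * B := by
  rw [secondMoment, sum_mul]
  calc ∑ r ∈ R, ‖permMean r‖ ^ 3 ≤ ∑ r ∈ R, ‖permMean r‖ ^ 2 * B :=
        sum_le_sum fun r hr => by
          rw [pow_succ]
          exact mul_le_mul_of_nonneg_left (hB r hr) (by positivity)
    _ ≤ _ := sum_le_sum_of_subset_of_nonneg (fun r hr => by simpa using hR r hr)
        fun _ _ _ => by positivity

/-- Vectors of support size `m` with more than `k` distinct nonzero values. -/
theorem sum_norm_cube_le_of_lt_nonzeroValues {m : ℕ} (k : ℕ) (hm : 2 * m ≤ n) :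
    ∑ r : ZMod n → ZMod n with hammingNorm r = m ∧ k ≤ nonzeroValues r, ‖permMean r‖ ^ 3 ≤
      11 ^ m / √(k !) := by
  have hn : (0 : ℝ) < n := by exact_mod_cast NeZero.pos n
  have h1 : ∀ r ∈ (univ.filter fun r : ZMod n → ZMod n =>
      hammingNorm r = m ∧ k ≤ nonzeroValues r), ‖permMean r‖ ≤
      √(12 ^ m * (m ! / (n : ℝ) ^ m) / k !) := by
    intro r hr
    obtain ⟨hr1, hr2⟩ := (mem_filter.1 hr).2
    refine Real.le_sqrt_of_sq_le ((norm_permMean_sq_le_of_hammingNorm r hr1 hm).trans ?_)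
    rw [mul_div_assoc, mul_div_assoc, div_right_comm (m ! : ℝ)]
    gcongr
    rw [le_div_iff₀ (by positivity)]
    have h2 := factorial_nonzeroValues_mul_le r
    rw [hr1] at h2
    have h3 : nonzeroFactorial r * k ! ≤ m ! :=
      (by rw [mul_comm]; gcongr : _ ≤ (nonzeroValues r)! * nonzeroFactorial r).trans h2
    exact_mod_cast h3
  refine (sum_norm_cube_le (fun r hr => (mem_filter.1 hr).2.1) h1 (by positivity)).trans ?_
  calc secondMoment n m * √(12 ^ m * (m ! / (n : ℝ) ^ m) / k !)
      ≤ 3 ^ m * √((n : ℝ) ^ m / m !) * √(12 ^ m * (m ! / (n : ℝ) ^ m) / k !) := by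
        gcongr
        exact secondMoment_le m
    _ = 3 ^ m * √(12 ^ m / k !) := by
        rw [mul_assoc, ← Real.sqrt_mul (by positivity)]
        congr 2
        field_simp
    _ = √(108 ^ m / k !) := by
        rw [show (3 : ℝ) ^ m = √(9 ^ m) by
          rw [show (9 : ℝ) = 3 ^ 2 by norm_num, ← pow_mul, mul_comm, pow_mul,
            Real.sqrt_sq (by positivity)], ← Real.sqrt_mul (by positivity)]
        congr 1
        rw [mul_div_assoc', ← mul_pow]
        norm_num
    _ ≤ √((11 ^ 2) ^ m / k !) := by
        gcongr
        norm_num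
    _ = _ := by
        rw [Real.sqrt_div (by positivity), ← pow_mul, mul_comm, pow_mul,
          Real.sqrt_sq (by positivity)]

theorem absThirdMoment_le {m : ℕ} (hm : 2 * m ≤ n) : absThirdMoment n m ≤ 11 ^ m := by
  have h := sum_norm_cube_le_of_lt_nonzeroValues (n := n) 0 hm
  simpa [absThirdMoment] using h

/-- Vectors of support size `m` with at most `k` distinct nonzero values. -/
theorem sum_norm_cube_le_of_nonzeroValues_le {m k : ℕ} (hk : k ≤ n) (hm : 2 * m ≤ n) :
    ∑ r : ZMod n → ZMod n with hammingNorm r = m ∧ nonzeroValues r ≤ k, ‖permMean r‖ ^ 3 ≤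
      (n.choose k * k.multichoose m : ℕ) * (42 ^ m * √(m ! / (n : ℝ) ^ m)) := by
  have hn : (0 : ℝ) < n := by exact_mod_cast NeZero.pos n
  set R := univ.filter fun r : ZMod n → ZMod n => hammingNorm r = m ∧ nonzeroValues r ≤ k
  have hB : ∀ r ∈ R, ((R.filter fun t => Function.update (mult t) 0 0 =
      Function.update (mult r) 0 0).card : ℝ) * ‖permMean r‖ ^ 3 ≤
      42 ^ m * √(m ! / (n : ℝ) ^ m) := by
    intro r hr
    obtain ⟨hr1, hr2⟩ := (mem_filter.1 hr).2
    have hw : (0 : ℝ) < nonzeroFactorial r := by exact_mod_cast nonzeroFactorial_pos r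
    have hw' : (nonzeroFactorial r : ℝ) ≤ m ! := by
      have h2 := factorial_nonzeroValues_mul_le r
      rw [hr1] at h2
      exact_mod_cast (Nat.le_mul_of_pos_left _ (Nat.factorial_pos _)).trans h2
    have hsub : (R.filter fun t => Function.update (mult t) 0 0 =
        Function.update (mult r) 0 0) ⊆ univ.filter fun t : ZMod n → ZMod n => mult t = mult r := by
      intro t ht
      simp only [R, mem_filter, mem_univ, true_and] at ht ⊢
      ext a
      rcases eq_or_ne a 0 with rfl | ha
      · rw [mult_zero_eq, mult_zero_eq, ht.1.1, hr1]
      · simpa [ha] using congrFun ht.2 a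
    have hcard : ((R.filter fun t => Function.update (mult t) 0 0 =
        Function.update (mult r) 0 0).card : ℝ) * nonzeroFactorial r ≤ n ^ m := by
      have h1 := card_mult_eq r
      rw [prod_factorial_mult, hr1, ZMod.card] at h1
      have h2 := card_le_card hsub
      have h3 : (n - m)! * n.descFactorial m = n ! := Nat.factorial_mul_descFactorial (by omega)
      have h4 : (univ.filter fun t : ZMod n → ZMod n => mult t = mult r).card * nonzeroFactorial r =
          n.descFactorial m := by
        refine Nat.eq_of_mul_eq_mul_left (Nat.factorial_pos (n - m)) ?_
        rw [h3, ← h1]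
        ring
      have h5 : (R.filter fun t => Function.update (mult t) 0 0 =
        Function.update (mult r) 0 0).card * nonzeroFactorial r ≤ n ^ m :=
        (Nat.mul_le_mul_right _ h2).trans (h4.le.trans (Nat.descFactorial_le_pow n m))
      exact_mod_cast h5
    have hF := norm_permMean_sq_le_of_hammingNorm r hr1 hm
    have hF1 : ‖permMean r‖ ≤ √(12 ^ m) * √(m ! / (n : ℝ) ^ m) := by
      rw [← Real.sqrt_mul (by positivity)]
      refine Real.le_sqrt_of_sq_le (hF.trans ?_)
      rw [mul_div_assoc]
      gcongr
    set C := ((R.filter fun t => Function.update (mult t) 0 0 =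
      Function.update (mult r) 0 0).card : ℝ)
    have hC : 0 ≤ C := Nat.cast_nonneg _
    calc C * ‖permMean r‖ ^ 3 = C * ‖permMean r‖ ^ 2 * ‖permMean r‖ := by ring
      _ ≤ C * (12 ^ m * nonzeroFactorial r / (n : ℝ) ^ m) * (√(12 ^ m) * √(m ! / (n : ℝ) ^ m)) := by
          gcongr
      _ = (C * nonzeroFactorial r / n ^ m) * (12 ^ m * √(12 ^ m)) * √(m ! / (n : ℝ) ^ m) := by ring
      _ ≤ 1 * (12 ^ m * √(12 ^ m)) * √(m ! / (n : ℝ) ^ m) := by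
          gcongr
          exact (div_le_one (by positivity)).2 hcard
      _ ≤ 42 ^ m * √(m ! / (n : ℝ) ^ m) := by
          rw [one_mul]
          gcongr
          rw [show (12 : ℝ) ^ m * √(12 ^ m) = √(1728 ^ m) by
            rw [show (1728 : ℝ) = 12 ^ 2 * 12 by norm_num, mul_pow, Real.sqrt_mul (by positivity),
              ← pow_mul, mul_comm 2 m, pow_mul, Real.sqrt_sq (by positivity)]]
          refine Real.sqrt_le_iff.2 ⟨by positivity, ?_⟩
          rw [← pow_mul, mul_comm m 2, pow_mul]
          gcongr
          norm_num
  refine (sum_le_card_mul_of_fiber R _ (fun t => Function.update (mult t) 0 0) _ hB).trans ?_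
  refine mul_le_mul_of_nonneg_right ?_ (by positivity)
  have hc := card_sum_eq_support_le (α := ZMod n) m k (by rwa [ZMod.card])
    (R.image fun t => Function.update (mult t) 0 0) fun a ha => by
      obtain ⟨r, hr, rfl⟩ := mem_image.1 ha
      obtain ⟨hr1, hr2⟩ := (mem_filter.1 hr).2
      constructor
      · rw [← add_sum_erase _ _ (mem_univ 0), Function.update_self, zero_add, ← hr1,
          ← sum_mult_erase]
        exact sum_congr rfl fun a ha => Function.update_of_ne (ne_of_mem_erase ha) _ _
      · refine (card_le_card fun a ha => ?_).trans hr2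
        simp only [mem_filter, mem_univ, true_and, mem_erase, and_true] at ha ⊢
        rcases eq_or_ne a 0 with rfl | h0
        · simp at ha
        · exact ⟨h0, by simpa [h0] using ha⟩
  rw [ZMod.card] at hc
  exact_mod_cast hc

end

theorem choose_mul_pow_le (N k : ℕ) {c : ℝ} (hc : 0 ≤ c) : (N.choose k : ℝ) * c ^ k ≤ Real.exp (c * N) := by
  have h1 : (N.choose k : ℝ) * c ^ k ≤ (c + 1) ^ N := by
    rcases le_or_gt k N with h | h
    · rw [add_pow]
      refine le_trans (le_of_eq ?_) (single_le_sum (f := fun m => c ^ m * 1 ^ (N - m) * (N.choose m : ℝ))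
        (fun _ _ => by positivity) (mem_range.2 (Nat.lt_succ_of_le h)))
      simp [mul_comm]
    · rw [Nat.choose_eq_zero_of_lt h]
      simp only [Nat.cast_zero, zero_mul]
      positivity
  refine h1.trans ?_
  rw [mul_comm, Real.exp_nat_mul]
  gcongr
  exact Real.add_one_le_exp c

theorem sum_filter_le_add {V : Type*} [Fintype V] {P Q S : V → Prop} [DecidablePred P]
    [DecidablePred Q] [DecidablePred S] (h : ∀ x, P x → Q x ∨ S x) {f : V → ℝ} (hf : ∀ x, 0 ≤ f x) :
    ∑ x with P x, f x ≤ ∑ x with Q x, f x + ∑ x with S x, f x := by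
  simp_rw [sum_filter]
  rw [← sum_add_distrib]
  refine sum_le_sum fun x _ => ?_
  have := h x
  have := hf x
  split_ifs <;> simp_all

/-! ### Vectors without a dominant value -/

section

variable {n : ℕ} [NeZero n]

/-- The number of distinct values of `r`. -/
def distinctValues (r : ZMod n → ZMod n) : ℕ := (univ.filter fun a => mult r a ≠ 0).card

theorem prod_mult_pow_pos (r : ZMod n → ZMod n) : 0 < ∏ a, (mult r a) ^ (mult r a) :=
  prod_pos fun _ _ => Nat.pow_self_pos

theorem factorial_distinctValues_mul_le (r : ZMod n → ZMod n) :
    (distinctValues r)! * ∏ a, (mult r a)! ≤ n ! := by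
  have h := factorial_card_mul_prod_le (univ.filter fun a => mult r a ≠ 0) (mult r)
    fun a ha => (mem_filter.1 ha).2
  have h1 : ∏ a ∈ univ.filter (fun a => mult r a ≠ 0), (mult r a)! = ∏ a, (mult r a)! :=
    prod_filter_of_ne fun a _ h h0 => h (by rw [h0]; rfl)
  have h2 : ∑ a ∈ univ.filter (fun a => mult r a ≠ 0), mult r a = n := by
    rw [sum_filter_of_ne fun a _ h => h, sum_mult, ZMod.card]
  rwa [h1, h2] at h

/-- Vectors with many distinct values have many rearrangements, so that the pointwise bound and
Parseval's identity suffice. -/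
theorem sum_norm_cube_le_of_le_distinctValues (k : ℕ) :
    ∑ r : ZMod n → ZMod n with k ≤ distinctValues r, ‖permMean r‖ ^ 3 ≤
      √(Real.exp (3 * n) / k !) := by
  have hn : (0 : ℝ) < n := by exact_mod_cast NeZero.pos n
  have he : (n : ℝ) ^ n / n ! ≤ Real.exp n := Real.pow_div_factorial_le_exp _ hn.le n
  have h1 : ∀ r ∈ univ.filter (fun r : ZMod n → ZMod n => k ≤ distinctValues r),
      ‖permMean r‖ ≤ √(Real.exp n / k !) := by
    intro r hr
    refine Real.le_sqrt_of_sq_le ((norm_permMean_sq_le r).trans ?_)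
    have hQ0 : (0 : ℝ) < (∏ a, (mult r a) ^ (mult r a) : ℕ) := by
      exact_mod_cast prod_mult_pow_pos r
    have hWQ : ((∏ a, (mult r a)! : ℕ) : ℝ) ≤ (∏ a, (mult r a) ^ (mult r a) : ℕ) := by
      exact_mod_cast prod_le_prod' fun a _ => Nat.factorial_le_pow _
    have hW : ((∏ a, (mult r a)! : ℕ) : ℝ) * k ! ≤ n ! := by
      have : (∏ a, (mult r a)!) * k ! ≤ n ! := by
        refine le_trans ?_ (factorial_distinctValues_mul_le r)
        rw [mul_comm]
        gcongr
        exact (mem_filter.1 hr).2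
      exact_mod_cast this
    calc ((∏ a, (mult r a)! : ℕ) : ℝ) ^ 2 * n ^ n /
          ((n ! : ℝ) ^ 2 * (∏ a, (mult r a) ^ (mult r a) : ℕ))
        = (((∏ a, (mult r a)! : ℕ) : ℝ) / (∏ a, (mult r a) ^ (mult r a) : ℕ)) *
          (((∏ a, (mult r a)! : ℕ) : ℝ) * k ! / n !) * (n ^ n / n !) / k ! := by
          field_simp
      _ ≤ 1 * 1 * Real.exp n / k ! := by
          gcongr
          · exact (div_le_one hQ0).2 hWQ
          · exact (div_le_one (by positivity)).2 hW
      _ = _ := by ring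
  calc ∑ r : ZMod n → ZMod n with k ≤ distinctValues r, ‖permMean r‖ ^ 3
      ≤ ∑ r : ZMod n → ZMod n with k ≤ distinctValues r,
        ‖permMean r‖ ^ 2 * √(Real.exp n / k !) := sum_le_sum fun r hr => by
          rw [pow_succ]
          exact mul_le_mul_of_nonneg_left (h1 r hr) (by positivity)
    _ ≤ ∑ r : ZMod n → ZMod n, ‖permMean r‖ ^ 2 * √(Real.exp n / k !) :=
        sum_le_sum_of_subset_of_nonneg (filter_subset _ _) fun _ _ _ => by positivity
    _ = n ^ n / n ! * √(Real.exp n / k !) := by rw [← sum_mul, sum_norm_sq_permMean]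
    _ ≤ Real.exp n * √(Real.exp n / k !) := by gcongr
    _ = √(Real.exp n ^ 2 * (Real.exp n / k !)) := by
        rw [Real.sqrt_mul (by positivity), Real.sqrt_sq (by positivity)]
    _ = _ := by
        rw [show 3 * (n : ℝ) = n + n + n by ring, Real.exp_add, Real.exp_add]
        congr 1
        ring

/-- The corrections to the entropy bound that come from Stirling's formula, for vectors with at
most `k` distinct values. They are subexponential if `k` is small compared with `n` and `c` is
chosen accordingly. -/
theorem prod_factorial_ratio_le (r : ZMod n → ZMod n) {k : ℕ} {c : ℝ} (hc : 0 < c) (hc1 : c ≤ 1)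
    (hk : distinctValues r ≤ k) :
    ((∏ a, (mult r a)! : ℕ) : ℝ) * n ^ n / (n ! * (∏ a, (mult r a) ^ (mult r a) : ℕ)) ≤
      Real.exp (c * n) / c ^ k := by
  have hn : (0 : ℝ) < n := by exact_mod_cast NeZero.pos n
  have he : (n : ℝ) ^ n / n ! ≤ Real.exp n := Real.pow_div_factorial_le_exp _ hn.le n
  have h1 : ∀ m : ℕ, m ≠ 0 → ((m ! : ℝ) / (m : ℝ) ^ m) * Real.exp m ≤ Real.exp (c * m) / c := by
    intro m hm
    have hm' : (0 : ℝ) < m := by exact_mod_cast Nat.pos_of_ne_zero hm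
    have h2 := factorial_mul_exp_le hm
    have h3 : Real.exp 1 * (c * m) ≤ Real.exp (c * m) := by
      have := Real.add_one_le_exp (c * m - 1)
      rw [Real.exp_sub, sub_add_cancel, le_div_iff₀ (Real.exp_pos 1)] at this
      linarith
    rw [le_div_iff₀ hc, div_mul_eq_mul_div, div_mul_eq_mul_div, div_le_iff₀ (by positivity)]
    calc (m ! : ℝ) * Real.exp m * c ≤ Real.exp 1 * m * (m : ℝ) ^ m * c := by gcongr
      _ = Real.exp 1 * (c * m) * (m : ℝ) ^ m := by ring
      _ ≤ _ := by gcongr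
  have h4 : ∏ a, (((mult r a)! : ℝ) / (mult r a : ℝ) ^ mult r a * Real.exp (mult r a)) ≤
      Real.exp (c * n) / c ^ k := by
    calc ∏ a, (((mult r a)! : ℝ) / (mult r a : ℝ) ^ mult r a * Real.exp (mult r a))
        = ∏ a with mult r a ≠ 0,
          (((mult r a)! : ℝ) / (mult r a : ℝ) ^ mult r a * Real.exp (mult r a)) := by
          refine (prod_filter_of_ne (p := fun a => mult r a ≠ 0) fun a _ h h0 => h ?_).symm
          simp [h0]
      _ ≤ ∏ a with mult r a ≠ 0, Real.exp (c * mult r a) / c :=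
          prod_le_prod (fun _ _ => by positivity) fun a ha => h1 _ (mem_filter.1 ha).2
      _ = Real.exp (c * n) / c ^ distinctValues r := by
          have h5 : ∑ a with mult r a ≠ 0, mult r a = n := by
            rw [sum_filter_of_ne fun a _ h => h, sum_mult, ZMod.card]
          rw [prod_div_distrib, prod_const, ← Real.exp_sum, ← mul_sum, ← Nat.cast_sum, h5]
          rfl
      _ ≤ _ := by
          gcongr _ / ?_
          exact pow_le_pow_of_le_one hc.le hc1 hk
  rw [prod_mul_distrib, prod_div_distrib, ← Real.exp_sum, ← Nat.cast_sum, sum_mult, ZMod.card] at h4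
  refine le_trans ?_ h4
  push_cast
  calc (∏ a, ((mult r a)! : ℝ)) * n ^ n / (n ! * ∏ a, (mult r a : ℝ) ^ mult r a)
      = (∏ a, ((mult r a)! : ℝ)) / (∏ a, (mult r a : ℝ) ^ mult r a) * (n ^ n / n !) := by
        rw [div_mul_div_comm, mul_comm (n ! : ℝ)]
    _ ≤ _ := by gcongr

/-- Vectors with few distinct values fall into few classes under rearrangement. -/
theorem sum_norm_cube_le_of_distinctValues_le {k L : ℕ} {c : ℝ} (hk : k ≤ n) (hc : 0 < c)
    (hc1 : c ≤ 1) :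
    ∑ r : ZMod n → ZMod n with (∀ a, mult r a ≤ L) ∧ distinctValues r ≤ k, ‖permMean r‖ ^ 3 ≤
      (n.choose k * k.multichoose n : ℕ) *
        ((Real.exp (c * n) / c ^ k) ^ 2 * √(((L : ℝ) / n) ^ n)) := by
  have hn : (0 : ℝ) < n := by exact_mod_cast NeZero.pos n
  set R := univ.filter fun r : ZMod n → ZMod n => (∀ a, mult r a ≤ L) ∧ distinctValues r ≤ k
  have hB : ∀ r ∈ R, ((R.filter fun t => mult t = mult r).card : ℝ) * ‖permMean r‖ ^ 3 ≤
      (Real.exp (c * n) / c ^ k) ^ 2 * √(((L : ℝ) / n) ^ n) := by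
    intro r hr
    obtain ⟨hr1, hr2⟩ := (mem_filter.1 hr).2
    have hW : (0 : ℝ) < (∏ a, (mult r a)! : ℕ) := by
      exact Nat.cast_pos.2 (prod_pos fun a _ => Nat.factorial_pos _)
    have hQ : (0 : ℝ) < (∏ a, (mult r a) ^ (mult r a) : ℕ) := by
      exact_mod_cast prod_mult_pow_pos r
    have hQL : ((∏ a, (mult r a) ^ (mult r a) : ℕ) : ℝ) ≤ (L : ℝ) ^ n := by
      have : ∏ a, (mult r a) ^ (mult r a) ≤ L ^ n := by
        calc ∏ a, (mult r a) ^ (mult r a) ≤ ∏ a, L ^ mult r a :=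
              prod_le_prod' fun a _ => Nat.pow_le_pow_left (hr1 a) _
          _ = L ^ n := by rw [prod_pow_eq_pow_sum, sum_mult, ZMod.card]
      exact_mod_cast this
    have hcard : ((R.filter fun t => mult t = mult r).card : ℝ) * (∏ a, (mult r a)! : ℕ) ≤ n ! := by
      have h1 := card_mult_eq r
      rw [ZMod.card] at h1
      have h2 : (R.filter fun t => mult t = mult r).card ≤
        (univ.filter fun t : ZMod n → ZMod n => mult t = mult r).card :=
        card_le_card (filter_subset_filter _ (subset_univ _))
      exact_mod_cast (Nat.mul_le_mul_right _ h2).trans h1.le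
    have hrho := prod_factorial_ratio_le r hc hc1 hr2
    have hF := norm_permMean_sq_le r
    set W : ℝ := ((∏ a, (mult r a)! : ℕ) : ℝ)
    set Q : ℝ := ((∏ a, (mult r a) ^ (mult r a) : ℕ) : ℝ)
    set C := ((R.filter fun t => mult t = mult r).card : ℝ)
    set ρ := W * n ^ n / (n ! * Q) with hρ
    have hρ0 : 0 ≤ ρ := by positivity
    have hF1 : ‖permMean r‖ ≤ ρ * √(((L : ℝ) / n) ^ n) := by
      rw [← Real.sqrt_sq hρ0, ← Real.sqrt_mul (by positivity)]
      refine Real.le_sqrt_of_sq_le (hF.trans ?_)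
      calc W ^ 2 * n ^ n / ((n ! : ℝ) ^ 2 * Q) = ρ ^ 2 * (Q / n ^ n) := by rw [hρ]; field_simp
        _ ≤ ρ ^ 2 * (L / n : ℝ) ^ n := by rw [div_pow (L : ℝ)]; gcongr
    have hC : C ≤ n ! / W := (le_div_iff₀ hW).2 hcard
    have hC0 : 0 ≤ C := Nat.cast_nonneg _
    calc C * ‖permMean r‖ ^ 3 = C * ‖permMean r‖ ^ 2 * ‖permMean r‖ := by ring
      _ ≤ (n ! / W) * (W ^ 2 * n ^ n / ((n ! : ℝ) ^ 2 * Q)) * (ρ * √(((L : ℝ) / n) ^ n)) := by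
          gcongr
      _ = ρ ^ 2 * √(((L : ℝ) / n) ^ n) := by rw [hρ]; field_simp
      _ ≤ _ := by gcongr
  refine (sum_le_card_mul_of_fiber R _ mult _ hB).trans ?_
  refine mul_le_mul_of_nonneg_right ?_ (by positivity)
  have h := card_sum_eq_support_le (α := ZMod n) n k (by rwa [ZMod.card]) (R.image mult)
    fun a ha => by
      obtain ⟨r, hr, rfl⟩ := mem_image.1 ha
      exact ⟨by rw [sum_mult, ZMod.card], (mem_filter.1 hr).2.2⟩
  rw [ZMod.card] at h
  exact_mod_cast h

end

theorem tendsto_exp_div_factorial_floor {A τ : ℝ} (hA : 0 ≤ A) (hτ : 0 < τ) :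
    Tendsto (fun n : ℕ => Real.exp (A * n) / (⌊τ * n⌋₊)!) atTop (𝓝 0) := by
  have h1 : Tendsto (fun n : ℕ => ⌊τ * n⌋₊) atTop atTop :=
    tendsto_nat_floor_atTop.comp (tendsto_natCast_atTop_atTop.const_mul_atTop hτ)
  have h2 := (FloorSemiring.tendsto_pow_div_factorial_atTop (Real.exp (A / τ))).comp h1
  have h3 := h2.const_mul (Real.exp (A / τ))
  rw [mul_zero] at h3
  refine squeeze_zero (fun _ => by positivity) (fun n => ?_) h3
  simp only [Function.comp_apply]
  rw [mul_div_assoc', ← pow_succ', ← Real.exp_nat_mul]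
  refine div_le_div_of_nonneg_right (Real.exp_le_exp.2 ?_) (by positivity)
  have h4 := (Nat.lt_floor_add_one (τ * n)).le
  push_cast
  calc A * n = (τ * n) * (A / τ) := by field_simp
    _ ≤ _ := by gcongr

/-- The vectors `r` without a value taken at more than `(1 - δ) n` coordinates contribute
`o(1)` to the third moment. -/
theorem eventually_sum_norm_cube_le {δ : ℝ} (hδ : 0 < δ) (hδ1 : δ < 1) {ε : ℝ} (hε : 0 < ε) :
    ∃ N : ℕ, ∀ n : ℕ, N ≤ n → ∀ [NeZero n], ∀ L : ℕ, (L : ℝ) ≤ (1 - δ) * n →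
      ∑ r : ZMod n → ZMod n with ∀ a, mult r a ≤ L, ‖permMean r‖ ^ 3 ≤ ε := by
  -- `c` and `τ` are so small that the factors `exp (c * n)` and `c ^ (-k)`, where `k ≤ τ n` bounds
  -- the number of distinct values, are absorbed by the entropy gain `exp (-δ n / 2)`
  set c : ℝ := δ / 20 with hc
  have hc0 : 0 < c := by positivity
  have hc1 : c ≤ 1 := by linarith
  have hlog : 1 ≤ Real.log c⁻¹ := by
    rw [Real.le_log_iff_exp_le (by positivity)]
    refine Real.exp_one_lt_three.le.trans ?_
    rw [le_inv_comm₀ (by norm_num) hc0]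
    linarith
  set τ : ℝ := δ / (32 * Real.log c⁻¹) with hτ
  have hτ0 : 0 < τ := by positivity
  have hτ1 : τ ≤ 1 := by
    rw [hτ, div_le_one (by positivity)]
    linarith
  have hlim1 : Tendsto (fun n : ℕ => √(Real.exp (3 * n) / (⌊τ * n⌋₊)!)) atTop (𝓝 0) := by
    have := (tendsto_exp_div_factorial_floor (A := 3) (by norm_num) hτ0).sqrt
    rwa [Real.sqrt_zero] at this
  have hlim2 : Tendsto (fun n : ℕ => Real.exp (-(δ / 8) * n)) atTop (𝓝 0) := by
    refine Real.tendsto_exp_atBot.comp ?_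
    exact tendsto_natCast_atTop_atTop.const_mul_atTop_of_neg (by linarith)
  have hlim := hlim1.add hlim2
  rw [add_zero] at hlim
  obtain ⟨N, hN⟩ := eventually_atTop.1 (hlim.eventually (ge_mem_nhds hε))
  refine ⟨N, fun n hn _ L hL => le_trans ?_ (hN n hn)⟩
  have hn0 : (0 : ℝ) < n := by exact_mod_cast NeZero.pos n
  set k := ⌊τ * n⌋₊ with hk
  have hkτ : (k : ℝ) ≤ τ * n := Nat.floor_le (by positivity)
  have hkn : k ≤ n := by
    have : (k : ℝ) ≤ n := hkτ.trans (by nlinarith)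
    exact_mod_cast this
  have hsplit : ∑ r : ZMod n → ZMod n with ∀ a, mult r a ≤ L, ‖permMean r‖ ^ 3 ≤
      ∑ r : ZMod n → ZMod n with k ≤ distinctValues r, ‖permMean r‖ ^ 3 +
      ∑ r : ZMod n → ZMod n with (∀ a, mult r a ≤ L) ∧ distinctValues r ≤ k, ‖permMean r‖ ^ 3 := by
    refine sum_filter_le_add (fun r hr => ?_) fun _ => by positivity
    rcases le_total k (distinctValues r) with h | h
    · exact Or.inl h
    · exact Or.inr ⟨hr, h⟩
  refine hsplit.trans (add_le_add (sum_norm_cube_le_of_le_distinctValues k) ?_)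
  refine (sum_norm_cube_le_of_distinctValues_le hkn hc0 hc1).trans ?_
  have hE1 : (n.choose k : ℝ) ≤ Real.exp (c * n) / c ^ k := by
    rw [le_div_iff₀ (by positivity)]
    exact choose_mul_pow_le n k hc0.le
  have hE2 : (k.multichoose n : ℝ) ≤ Real.exp (2 * (c * n)) / c ^ k := by
    rw [le_div_iff₀ (by positivity)]
    have h1 : k.multichoose n ≤ (n + k).choose k := by
      rw [Nat.multichoose_eq, ← Nat.choose_symm_add, add_comm n k]
      exact Nat.choose_le_choose _ (Nat.sub_le _ _)
    calc (k.multichoose n : ℝ) * c ^ k ≤ (n + k).choose k * c ^ k := by gcongr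
      _ ≤ Real.exp (c * (n + k : ℕ)) := choose_mul_pow_le _ k hc0.le
      _ ≤ _ := by
          refine Real.exp_le_exp.2 ?_
          have : (k : ℝ) ≤ n := by exact_mod_cast hkn
          push_cast
          nlinarith
  have hE3 : √(((L : ℝ) / n) ^ n) ≤ Real.exp (-(δ / 2) * n) := by
    refine Real.sqrt_le_iff.2 ⟨by positivity, ?_⟩
    rw [← Real.exp_nat_mul]
    have h1 : (L : ℝ) / n ≤ Real.exp (-δ) := by
      rw [div_le_iff₀ hn0]
      refine hL.trans ?_
      gcongr
      linarith [Real.add_one_le_exp (-δ)]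
    calc ((L : ℝ) / n) ^ n ≤ Real.exp (-δ) ^ n := by gcongr
      _ = _ := by
          rw [← Real.exp_nat_mul]
          congr 1
          push_cast
          ring
  have hE4 : 1 / c ^ k ≤ Real.exp (δ / 32 * n) := by
    rw [one_div, ← inv_pow, ← Real.exp_log (inv_pos.2 hc0), ← Real.exp_nat_mul]
    refine Real.exp_le_exp.2 ?_
    calc (k : ℝ) * Real.log c⁻¹ ≤ τ * n * Real.log c⁻¹ := by gcongr
      _ = τ * Real.log c⁻¹ * n := by ring
      _ = _ := by
          rw [hτ, div_mul_eq_mul_div, mul_div_mul_right _ _ (by positivity)]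
  calc ((n.choose k * k.multichoose n : ℕ) : ℝ) *
        ((Real.exp (c * n) / c ^ k) ^ 2 * √(((L : ℝ) / n) ^ n))
      ≤ (Real.exp (c * n) / c ^ k * (Real.exp (2 * (c * n)) / c ^ k)) *
        ((Real.exp (c * n) / c ^ k) ^ 2 * Real.exp (-(δ / 2) * n)) := by
        push_cast
        gcongr
    _ = Real.exp (c * n) * Real.exp (2 * (c * n)) * Real.exp (c * n) * Real.exp (c * n) *
        Real.exp (-(δ / 2) * n) * (1 / c ^ k) ^ 4 := by
        field_simp
    _ ≤ Real.exp (c * n) * Real.exp (2 * (c * n)) * Real.exp (c * n) * Real.exp (c * n) *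
        Real.exp (-(δ / 2) * n) * Real.exp (δ / 32 * n) ^ 4 := by gcongr
    _ = Real.exp (-(δ / 8) * n) := by
        rw [← Real.exp_nat_mul, ← Real.exp_add, ← Real.exp_add, ← Real.exp_add, ← Real.exp_add,
          ← Real.exp_add]
        congr 1
        rw [hc]
        push_cast
        ring

/-! ### Vectors with a dominant zero -/

/-- The third moment over the vectors with `m` nonzero coordinates decays geometrically in `m`, in
the range `M ≤ m ≤ δ n`. If such a vector has more than `m / 4` distinct nonzero values, then its
number of rearrangements is superexponential in `m`; the remaining ones are few. -/
theorem exists_absThirdMoment_le : ∃ δ : ℝ, 0 < δ ∧ δ < 1 / 2 ∧ ∃ M : ℕ, ∀ n m : ℕ, ∀ [NeZero n],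
    M ≤ m → (m : ℝ) ≤ δ * n → absThirdMoment n m ≤ (1 / 2) ^ m := by
  have hlim := tendsto_exp_div_factorial_floor (A := 8) (τ := 1 / 4) (by norm_num) (by norm_num)
  obtain ⟨M, hM⟩ := eventually_atTop.1 (hlim.eventually (ge_mem_nhds (show (0 : ℝ) < 1 / 4 by norm_num)))
  refine ⟨1 / 2016 ^ 4, by norm_num, by norm_num, max M 1, fun n m _ hm hmn => ?_⟩
  have hn0 : (0 : ℝ) < n := by exact_mod_cast NeZero.pos n
  have hm1 : 1 ≤ m := (le_max_right _ _).trans hm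
  have hm0 : (0 : ℝ) < m := by exact_mod_cast hm1
  have h2m : 2 * m ≤ n := by
    have : 2 * (m : ℝ) ≤ n := by linarith
    exact_mod_cast this
  set k := m / 4 with hk
  have hkm : 4 * k ≤ m := Nat.mul_div_le m 4
  have hsplit : absThirdMoment n m ≤
      ∑ r : ZMod n → ZMod n with hammingNorm r = m ∧ k ≤ nonzeroValues r, ‖permMean r‖ ^ 3 +
      ∑ r : ZMod n → ZMod n with hammingNorm r = m ∧ nonzeroValues r ≤ k, ‖permMean r‖ ^ 3 := by
    refine sum_filter_le_add (fun r hr => ?_) fun _ => by positivity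
    rcases le_total k (nonzeroValues r) with h | h
    · exact Or.inl ⟨hr, h⟩
    · exact Or.inr ⟨hr, h⟩
  have hA : (11 : ℝ) ^ m / √(k !) ≤ (1 / 2) * (1 / 2) ^ m := by
    have h1 := hM m ((le_max_left _ _).trans hm)
    have h2 : ⌊(1 / 4 : ℝ) * m⌋₊ = k := by
      rw [one_div_mul_eq_div]
      exact_mod_cast Nat.floor_div_eq_div (K := ℝ) m 4
    rw [h2, div_le_iff₀ (by positivity)] at h1
    have h3 : 2 * (22 : ℝ) ^ m ≤ √(k !) := by
      refine Real.le_sqrt_of_sq_le ?_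
      have h4 : ((22 : ℝ) ^ 2) ^ m ≤ Real.exp (8 * m) := by
        rw [mul_comm, Real.exp_nat_mul]
        gcongr
        rw [show (8 : ℝ) = (8 : ℕ) * 1 by norm_num, Real.exp_nat_mul]
        calc (22 : ℝ) ^ 2 ≤ 2.7 ^ 8 := by norm_num
          _ ≤ _ := by
            gcongr
            linarith [Real.exp_one_gt_d9]
      rw [mul_pow, ← pow_mul, mul_comm m 2, pow_mul]
      linarith
    rw [div_le_iff₀ (by positivity)]
    calc (11 : ℝ) ^ m = (1 / 2) * (1 / 2) ^ m * (2 * 22 ^ m) := by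
          rw [show (22 : ℝ) = 2 * 11 by norm_num, mul_pow, one_div, inv_pow]
          field_simp
      _ ≤ _ := by gcongr
  have hB : ((n.choose k * k.multichoose m : ℕ) : ℝ) * (42 ^ m * √(m ! / (n : ℝ) ^ m)) ≤
      (1 / 2) * (1 / 2) ^ m := by
    set y : ℝ := ((n : ℝ) / m) ^ (1 / 4 : ℝ) with hy
    have hy4 : y ^ 4 = n / m := by
      rw [hy, ← Real.rpow_natCast, ← Real.rpow_mul (by positivity)]
      norm_num
    have hy0 : 0 < y := by positivity
    have hy1 : 2016 ≤ y := by
      refine le_of_pow_le_pow_left₀ (n := 4) (by norm_num) hy0.le ?_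
      rw [hy4, le_div_iff₀ hm0]
      rw [one_div_mul_eq_div, le_div_iff₀ (by norm_num)] at hmn
      linarith
    have h1 : (n.choose k : ℝ) ≤ 3 ^ m * y ^ m := by
      have h := choose_mul_pow_le n k (c := m / n) (by positivity)
      rw [div_mul_cancel₀ _ hn0.ne', ← one_div_div, ← hy4, one_div, inv_pow,
        mul_inv_le_iff₀ (by positivity)] at h
      refine h.trans ?_
      gcongr
      · rw [← mul_one (m : ℝ), Real.exp_nat_mul]
        gcongr
        exact Real.exp_one_lt_three.le
      · rw [← pow_mul]
        exact pow_le_pow_right₀ (by linarith) hkm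
    have h2 : (k.multichoose m : ℝ) ≤ 4 ^ m := by
      have : k.multichoose m ≤ 4 ^ m := by
        rw [Nat.multichoose_eq]
        refine (Nat.choose_le_two_pow _ _).trans ?_
        rw [show 4 = 2 ^ 2 by norm_num, ← pow_mul]
        exact Nat.pow_le_pow_right (by norm_num) (by omega)
      exact_mod_cast this
    have h3 : √(m ! / (n : ℝ) ^ m) ≤ 1 / (y ^ m) ^ 2 := by
      refine Real.sqrt_le_iff.2 ⟨by positivity, ?_⟩
      have h4 : (m ! : ℝ) ≤ (m : ℝ) ^ m := by exact_mod_cast Nat.factorial_le_pow m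
      calc (m ! : ℝ) / n ^ m ≤ m ^ m / n ^ m := by gcongr
        _ = 1 / (n / m) ^ m := by rw [div_pow]; field_simp
        _ = _ := by rw [← hy4]; ring
    push_cast
    calc (n.choose k : ℝ) * k.multichoose m * (42 ^ m * √(m ! / (n : ℝ) ^ m))
        ≤ 3 ^ m * y ^ m * 4 ^ m * (42 ^ m * (1 / (y ^ m) ^ 2)) := by gcongr
      _ = (504 / y) ^ m := by
          rw [div_pow, show (504 : ℝ) = 3 * 4 * 42 by norm_num, mul_pow, mul_pow]
          field_simp
      _ ≤ (1 / 4) ^ m := by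
          refine pow_le_pow_left₀ (by positivity) ?_ m
          rw [div_le_div_iff₀ hy0 (by norm_num)]
          linarith
      _ = (1 / 2) ^ m * (1 / 2) ^ m := by rw [← mul_pow]; norm_num
      _ ≤ _ := by
          gcongr
          calc (1 / 2 : ℝ) ^ m ≤ (1 / 2) ^ 1 := pow_le_pow_of_le_one (by norm_num) (by norm_num) hm1
            _ = _ := by norm_num
  calc absThirdMoment n m ≤ _ := hsplit
    _ ≤ _ := add_le_add (sum_norm_cube_le_of_lt_nonzeroValues k h2m)
        (sum_norm_cube_le_of_nonzeroValues_le (by omega) h2m)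
    _ ≤ (1 / 2) * (1 / 2) ^ m + (1 / 2) * (1 / 2) ^ m := add_le_add hA hB
    _ = _ := by ring

/-! ### The third moment at bounded support size -/

theorem exists_norm_add_cube_sub_le {η : ℝ} (hη : 0 < η) :
    ∃ C : ℝ, 0 ≤ C ∧ ∀ x y : ℂ, ‖(x + y) ^ 3 - x ^ 3‖ ≤ η * ‖x‖ ^ 3 + C * ‖y‖ ^ 3 := by
  set θ : ℝ := min 1 (η / 7) with hθ
  have hθ0 : 0 < θ := lt_min one_pos (by positivity)
  have hθ1 : θ ≤ 1 := min_le_left _ _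
  have hθη : 7 * θ ≤ η := by linarith [min_le_right 1 (η / 7)]
  refine ⟨7 / θ ^ 2, by positivity, fun x y => ?_⟩
  have h1 : ‖(x + y) ^ 3 - x ^ 3‖ ≤ 3 * ‖x‖ ^ 2 * ‖y‖ + 3 * ‖x‖ * ‖y‖ ^ 2 + ‖y‖ ^ 3 := by
    have : (x + y) ^ 3 - x ^ 3 = 3 * x ^ 2 * y + 3 * x * y ^ 2 + y ^ 3 := by ring
    rw [this]
    refine (norm_add₃_le).trans (le_of_eq ?_)
    simp
  refine h1.trans ?_
  have hx := norm_nonneg x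
  have hy := norm_nonneg y
  set a := ‖x‖
  set b := ‖y‖
  rcases le_total b (θ * a) with h | h
  · have hba : b ≤ a := h.trans (by nlinarith)
    have e1 : a ^ 2 * b ≤ θ * a ^ 3 := by
      calc a ^ 2 * b ≤ a ^ 2 * (θ * a) := by gcongr
        _ = _ := by ring
    have e2 : a * b ^ 2 ≤ a ^ 2 * b := by
      calc a * b ^ 2 = a * b * b := by ring
        _ ≤ a * b * a := by gcongr
        _ = _ := by ring
    have e3 : b ^ 3 ≤ a ^ 2 * b := by
      calc b ^ 3 = b ^ 2 * b := by ring
        _ ≤ a ^ 2 * b := by gcongr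
    have e4 : 7 * θ * a ^ 3 ≤ η * a ^ 3 := by gcongr
    have e5 : 0 ≤ 7 / θ ^ 2 * b ^ 3 := by positivity
    linarith
  · have hab : a ≤ b / θ := by rw [le_div_iff₀ hθ0]; linarith
    have hbb : b ≤ b / θ := by rw [le_div_iff₀ hθ0]; nlinarith
    have e1 : a ^ 2 * b ≤ (b / θ) ^ 2 * b := by gcongr
    have e2 : a * b ^ 2 ≤ (b / θ) ^ 2 * b := by
      calc a * b ^ 2 = a * b * b := by ring
        _ ≤ (b / θ) * (b / θ) * b := by gcongr
        _ = _ := by ring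
    have e3 : b ^ 3 ≤ (b / θ) ^ 2 * b := by
      calc b ^ 3 = b ^ 2 * b := by ring
        _ ≤ _ := by gcongr
    have e4 : 7 / θ ^ 2 * b ^ 3 = 7 * ((b / θ) ^ 2 * b) := by field_simp
    have e5 : 0 ≤ η * a ^ 3 := by positivity
    linarith

theorem norm_sum_cube_le {κ : Type*} (K : Finset κ) (x : κ → ℂ) {m : ℕ} (hK : K.card ≤ m) :
    ‖∑ k ∈ K, x k‖ ^ 3 ≤ (m : ℝ) ^ 2 * ∑ k ∈ K, ‖x k‖ ^ 3 := by
  rcases K.eq_empty_or_nonempty with rfl | hne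
  · simp
  have h := pow_sum_div_card_le_sum_pow (s := K) (f := fun k => ‖x k‖) (fun _ _ => norm_nonneg _) 2
  have hc : (0 : ℝ) < K.card := by exact_mod_cast hne.card_pos
  rw [div_le_iff₀ (by positivity)] at h
  calc ‖∑ k ∈ K, x k‖ ^ 3 ≤ (∑ k ∈ K, ‖x k‖) ^ 3 := by gcongr; exact norm_sum_le _ _
    _ ≤ (∑ k ∈ K, ‖x k‖ ^ 3) * (K.card : ℝ) ^ 2 := h
    _ ≤ (∑ k ∈ K, ‖x k‖ ^ 3) * (m : ℝ) ^ 2 := by gcongr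
    _ = _ := mul_comm _ _

theorem norm_sum_cube_sub_le {κ : Type*} [DecidableEq κ] (K : Finset κ) (x : κ → ℂ) {m : ℕ}
    (hK : K.card ≤ m) :
    ‖(∑ k ∈ K, x k) ^ 3 - ∑ k ∈ K, x k ^ 3‖ ≤
      ((m : ℝ) ^ 2 + 1) * ∑ k ∈ K, if ∃ l ∈ K, l ≠ k then ‖x k‖ ^ 3 else 0 := by
  rcases lt_or_ge 1 K.card with h | h
  · have h1 : ∑ k ∈ K, (if ∃ l ∈ K, l ≠ k then ‖x k‖ ^ 3 else 0) = ∑ k ∈ K, ‖x k‖ ^ 3 :=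
      sum_congr rfl fun k _ => if_pos (exists_mem_ne h k)
    rw [h1, add_mul, one_mul]
    refine (norm_sub_le _ _).trans (add_le_add ?_ ?_)
    · rw [norm_pow]
      exact norm_sum_cube_le K x hK
    · exact (norm_sum_le _ _).trans (le_of_eq (by simp_rw [norm_pow]))
  · have h0 : (∑ k ∈ K, x k) ^ 3 - ∑ k ∈ K, x k ^ 3 = 0 := by
      rcases Nat.le_one_iff_eq_zero_or_eq_one.1 h with h | h
      · rw [card_eq_zero] at h
        simp [h]
      · obtain ⟨a, rfl⟩ := card_eq_one.1 h
        simp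
    rw [h0, norm_zero]
    exact mul_nonneg (by positivity) (sum_nonneg fun k _ => by split_ifs <;> positivity)

section

variable {n : ℕ} [NeZero n]

theorem sum_cancel_eq {M : Type*} [AddCommMonoid M] (m : ℕ)
    (g : ZMod n → ZMod n → (ZMod n → ZMod n) → M) :
    ∑ i, ∑ v with v ≠ 0, ∑ r with hammingNorm r = m + 1 ∧ r i = 0,
      ∑ k with r k = -v, g k v (r + coordVec k v) =
    ∑ r with hammingNorm r = m, ∑ p ∈ (univ.filter fun i => r i = 0).offDiag,
      ∑ v with v ≠ 0, g p.2 v r := by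
  have h1 : ∀ i v : ZMod n, v ≠ 0 → ∑ r with hammingNorm r = m + 1 ∧ r i = 0,
      ∑ k with r k = -v, g k v (r + coordVec k v) =
      ∑ r with hammingNorm r = m, ∑ k with r i = 0 ∧ r k = 0 ∧ i ≠ k, g k v r := by
    intro i v hv
    have h2 : ∑ r with hammingNorm r = m + 1 ∧ r i = 0,
        ∑ k with r k = -v, g k v (r + coordVec k v) =
        ∑ k, ∑ r with hammingNorm r = m + 1 ∧ r i = 0 ∧ r k = -v, g k v (r + coordVec k v) :=
      sum_comm' fun r k => by simp only [mem_filter, mem_univ, true_and]; tauto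
    have h3 : ∑ r with hammingNorm r = m, ∑ k with r i = 0 ∧ r k = 0 ∧ i ≠ k, g k v r =
        ∑ k, ∑ r with hammingNorm r = m ∧ r i = 0 ∧ r k = 0 ∧ i ≠ k, g k v r :=
      sum_comm' fun r k => by simp only [mem_filter, mem_univ, true_and, and_true]
    rw [h2, h3]
    refine sum_congr rfl fun k _ => ?_
    rcases eq_or_ne i k with rfl | hik
    · rw [filter_false_of_mem, sum_empty, filter_false_of_mem, sum_empty]
      · rintro r - ⟨-, -, -, h⟩
        exact h rfl
      · rintro r - ⟨-, h, h'⟩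
        exact hv (by simpa [h] using h')
    · rw [sum_add_coordVec_cancel m hik hv]
      simp [hik]
  have h4 : ∑ i, ∑ v with v ≠ 0, ∑ r with hammingNorm r = m + 1 ∧ r i = 0,
      ∑ k with r k = -v, g k v (r + coordVec k v) =
      ∑ i, ∑ v with v ≠ 0, ∑ r with hammingNorm r = m,
        ∑ k with r i = 0 ∧ r k = 0 ∧ i ≠ k, g k v r :=
    sum_congr rfl fun i _ => sum_congr rfl fun v hv => h1 i v (mem_filter.1 hv).2
  rw [h4]
  simp_rw [sum_comm (s := univ.filter fun v : ZMod n => v ≠ 0)]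
  rw [sum_comm]
  refine sum_congr rfl fun r _ => ?_
  rw [sum_sigma']
  refine sum_nbij' (fun p => (p.1, p.2)) (fun p => ⟨p.1, p.2⟩) ?_ ?_ ?_ ?_ ?_
  · rintro ⟨i, k⟩ h
    simpa using h
  · rintro ⟨i, k⟩ h
    simpa using h
  · rintro ⟨i, k⟩ _; rfl
  · rintro ⟨i, k⟩ _; rfl
  · rintro ⟨i, k⟩ _; rfl

theorem card_offDiag_zeros {r : ZMod n → ZMod n} {m : ℕ} (hr : hammingNorm r = m) :
    ((univ.filter fun i => r i = 0).offDiag.card : ℝ) = (n - m) * (n - m - 1) := by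
  have h3 := card_filter_eq_zero r
  rw [hr] at h3
  rw [offDiag_card, Nat.cast_sub (Nat.le_mul_self _)]
  push_cast
  rw [h3]
  ring

theorem card_filter_ne_zero : ((univ.filter fun v : ZMod n => v ≠ 0).card : ℝ) = n - 1 := by
  rw [filter_ne', card_erase_of_mem (mem_univ _), card_univ, ZMod.card, Nat.cast_sub NeZero.one_le,
    Nat.cast_one]

/-- The sum of `permMean r ^ 3` over the vectors `r` with exactly `m` nonzero coordinates. -/
noncomputable def thirdMoment (n m : ℕ) [NeZero n] : ℂ :=
  ∑ r : ZMod n → ZMod n with hammingNorm r = m, permMean r ^ 3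

theorem norm_thirdMoment_le (m : ℕ) : ‖thirdMoment n m‖ ≤ absThirdMoment n m :=
  (norm_sum_le _ _).trans (le_of_eq (by simp_rw [norm_pow]; rfl))

theorem absThirdMoment_nonneg (m : ℕ) : 0 ≤ absThirdMoment n m :=
  sum_nonneg fun _ _ => by positivity

theorem sum_cancel_cube (m : ℕ) :
    ∑ i : ZMod n, ∑ v with v ≠ 0, ∑ r with hammingNorm r = m + 1 ∧ r i = 0,
      ∑ k with r k = -v, permMean (r + coordVec k v) ^ 3 =
    (n - m) * (n - m - 1) * (n - 1) * thirdMoment n m := by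
  rw [sum_cancel_eq m (fun _ _ r => permMean r ^ 3), thirdMoment, mul_sum]
  refine sum_congr rfl fun r hr => ?_
  have h1 := congrArg Complex.ofReal (card_offDiag_zeros (mem_filter.1 hr).2)
  have h2 := congrArg Complex.ofReal (card_filter_ne_zero (n := n))
  simp only [sum_const, nsmul_eq_mul]
  push_cast at h1 h2
  rw [h1, h2]
  ring

theorem sum_cancel_norm_cube_le {m : ℕ} (hm : m + 1 ≤ n) :
    ∑ i : ZMod n, ∑ v with v ≠ 0, ∑ r with hammingNorm r = m + 1 ∧ r i = 0,
      ∑ k with r k = -v, ‖permMean (r + coordVec k v)‖ ^ 3 ≤ n ^ 3 * absThirdMoment n m := by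
  rw [sum_cancel_eq m (fun _ _ r => ‖permMean r‖ ^ 3), absThirdMoment, mul_sum]
  refine sum_le_sum fun r hr => ?_
  simp only [sum_const, nsmul_eq_mul]
  rw [card_offDiag_zeros (mem_filter.1 hr).2, card_filter_ne_zero, ← mul_assoc]
  gcongr
  have h1 : (m : ℝ) + 1 ≤ n := by exact_mod_cast hm
  have h0 : (0 : ℝ) ≤ m := Nat.cast_nonneg _
  calc ((n : ℝ) - m) * (n - m - 1) * (n - 1) ≤ n * n * n := by
        gcongr <;> linarith
    _ = _ := by ring

/-- The vectors in which the cancelled value `v` occurs once more are negligible, as they leave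
fewer choices for `v`. -/
theorem sum_cancel_repeated_le (m : ℕ) :
    ∑ i : ZMod n, ∑ v with v ≠ 0, ∑ r with hammingNorm r = m + 1 ∧ r i = 0,
      ∑ k with r k = -v, (if ∃ l ∈ univ.filter (fun k => r k = -v), l ≠ k then
        ‖permMean (r + coordVec k v)‖ ^ 3 else 0) ≤ n ^ 2 * m * absThirdMoment n m := by
  have h1 : ∀ (r : ZMod n → ZMod n) (k v : ZMod n),
      (∃ l ∈ univ.filter (fun k => r k = -v), l ≠ k) ↔ ∃ l, l ≠ k ∧ (r + coordVec k v) l = -v :=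
    fun r k v => by
      simp only [mem_filter, mem_univ, true_and]
      refine exists_congr fun l => ?_
      rw [and_comm]
      refine and_congr_right fun h => ?_
      simp [h]
  simp_rw [h1]
  rw [sum_cancel_eq m (fun k v r => if ∃ l, l ≠ k ∧ r l = -v then ‖permMean r‖ ^ 3 else 0),
    absThirdMoment, mul_sum]
  refine sum_le_sum fun r hr => ?_
  have hr := (mem_filter.1 hr).2
  have h2 : ∀ k : ZMod n, ∑ v with v ≠ 0,
      (if ∃ l, l ≠ k ∧ r l = -v then ‖permMean r‖ ^ 3 else 0) ≤ m * ‖permMean r‖ ^ 3 := by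
    intro k
    rw [← sum_filter, sum_const, nsmul_eq_mul]
    gcongr
    rw [← hr, hammingNorm, ← card_image_of_injective _ neg_injective]
    refine (card_le_card (t := (univ.filter fun i => r i ≠ 0).image r) fun v hv => ?_).trans
      card_image_le
    simp only [mem_image, mem_filter, mem_univ, true_and] at hv ⊢
    obtain ⟨w, ⟨hw, l, -, hl⟩, rfl⟩ := hv
    exact ⟨l, by rw [hl]; simpa using hw, hl⟩
  calc _ ≤ ∑ p ∈ (univ.filter fun i => r i = 0).offDiag, (m : ℝ) * ‖permMean r‖ ^ 3 :=
        sum_le_sum fun p _ => h2 p.2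
    _ = ((univ.filter fun i => r i = 0).offDiag.card : ℝ) * (m * ‖permMean r‖ ^ 3) := by
        rw [sum_const, nsmul_eq_mul]
    _ ≤ n ^ 2 * (m * ‖permMean r‖ ^ 3) := by
        gcongr
        have : (univ.filter fun i => r i = 0).offDiag.card ≤ n ^ 2 := by
          refine (card_le_univ _).trans (le_of_eq ?_)
          rw [Fintype.card_prod, ZMod.card, sq]
        exact_mod_cast this
    _ = _ := by ring

theorem sum_merge_norm_cube_le (m : ℕ) :
    ∑ i : ZMod n, ∑ v with v ≠ 0, ∑ r with hammingNorm r = m ∧ r i = 0,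
      ∑ k with r k ≠ 0 ∧ r k ≠ -v, ‖permMean (r + coordVec k v)‖ ^ 3 ≤
        n ^ 2 * m * absThirdMoment n m := by
  have h1 : ∀ i v : ZMod n, ∑ r with hammingNorm r = m ∧ r i = 0,
      ∑ k with r k ≠ 0 ∧ r k ≠ -v, ‖permMean (r + coordVec k v)‖ ^ 3 ≤ m * absThirdMoment n m := by
    intro i v
    calc ∑ r with hammingNorm r = m ∧ r i = 0,
          ∑ k with r k ≠ 0 ∧ r k ≠ -v, ‖permMean (r + coordVec k v)‖ ^ 3
        = ∑ k, ∑ r with hammingNorm r = m ∧ r i = 0 ∧ r k ≠ 0 ∧ r k ≠ -v,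
          ‖permMean (r + coordVec k v)‖ ^ 3 :=
          sum_comm' fun r k => by simp only [mem_filter, mem_univ, true_and]; tauto
      _ = ∑ k, ∑ r with hammingNorm r = m ∧ r i = 0 ∧ r k ≠ 0 ∧ r k ≠ v, ‖permMean r‖ ^ 3 :=
          sum_congr rfl fun k _ => sum_add_coordVec_of_ne m i k v (fun r => ‖permMean r‖ ^ 3)
      _ ≤ ∑ k, ∑ r with hammingNorm r = m ∧ r k ≠ 0, ‖permMean r‖ ^ 3 := by
          refine sum_le_sum fun k _ => sum_le_sum_of_subset_of_nonneg (fun r hr => ?_)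
            fun _ _ _ => by positivity
          simp only [mem_filter, mem_univ, true_and] at hr ⊢
          exact ⟨hr.1, hr.2.2.1⟩
      _ = ∑ r with hammingNorm r = m, ∑ k with r k ≠ 0, ‖permMean r‖ ^ 3 :=
          sum_comm' fun k r => by simp only [mem_filter, mem_univ, true_and]; tauto
      _ = _ := by
          rw [absThirdMoment, mul_sum]
          refine sum_congr rfl fun r hr => ?_
          rw [sum_const, nsmul_eq_mul, ← (mem_filter.1 hr).2]
          rfl
  calc _ ≤ ∑ i : ZMod n, ∑ v : ZMod n with v ≠ 0, m * absThirdMoment n m :=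
        sum_le_sum fun i _ => sum_le_sum fun v _ => h1 i v
    _ = n * ((n - 1) * (m * absThirdMoment n m)) := by
        simp only [sum_const, nsmul_eq_mul, card_filter_ne_zero, card_univ, ZMod.card]
    _ ≤ n * (n * (m * absThirdMoment n m)) := by
        have := absThirdMoment_nonneg (n := n) m
        gcongr
        linarith
    _ = _ := by ring

end

/-- An approximate recursion for the third moments. In the cube of the right hand side of
`permMean_recursion` only the terms in which two coordinates cancel contribute to the main term. -/
theorem exists_thirdMoment_recursion (m : ℕ) : ∃ A : ℝ, 0 ≤ A ∧ ∀ η : ℝ, 0 < η → ∃ B : ℝ,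
    ∀ n : ℕ, ∀ [NeZero n], 2 * (m + 2) ≤ n →
      ‖((n : ℂ) - (m + 1)) ^ 3 * ((m + 2) * thirdMoment n (m + 2)) +
        (n - m) * (n - m - 1) * (n - 1) * thirdMoment n m‖ ≤ η * A * n ^ 3 + B * n ^ 2 := by
  refine ⟨(m + 1) ^ 2 * 11 ^ m, by positivity, fun η hη => ?_⟩
  obtain ⟨C, hC0, hC⟩ := exists_norm_add_cube_sub_le hη
  refine ⟨C * (m + 1) ^ 2 * ((m + 1) * 11 ^ (m + 1)) + ((m + 1) ^ 2 + 1) * (m * 11 ^ m),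
    fun n _ hn => ?_⟩
  have hE0 := absThirdMoment_le (n := n) (m := m) (by omega)
  have hE1 := absThirdMoment_le (n := n) (m := m + 1) (by omega)
  -- the cube of the sum of all terms, compared with the sum of the cubes of the cancelling ones
  have hpt : ∀ (r : ZMod n → ZMod n) (v : ZMod n), v ≠ 0 → hammingNorm r = m + 1 →
      ‖(∑ k with r k ≠ 0, permMean (r + coordVec k v)) ^ 3 -
        ∑ k with r k = -v, permMean (r + coordVec k v) ^ 3‖ ≤
      η * (m + 1) ^ 2 * ∑ k with r k = -v, ‖permMean (r + coordVec k v)‖ ^ 3 +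
      C * (m + 1) ^ 2 * ∑ k with r k ≠ 0 ∧ r k ≠ -v, ‖permMean (r + coordVec k v)‖ ^ 3 +
      ((m + 1) ^ 2 + 1) * ∑ k with r k = -v,
        (if ∃ l ∈ univ.filter (fun k => r k = -v), l ≠ k then
          ‖permMean (r + coordVec k v)‖ ^ 3 else 0) := by
    intro r v hv hr
    have hsplit : ∑ k with r k ≠ 0, permMean (r + coordVec k v) =
        ∑ k with r k = -v, permMean (r + coordVec k v) +
        ∑ k with r k ≠ 0 ∧ r k ≠ -v, permMean (r + coordVec k v) := by
      rw [← sum_filter_add_sum_filter_not (univ.filter fun k => r k ≠ 0) (fun k => r k = -v),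
        filter_filter, filter_filter]
      congr 1
      refine sum_congr (filter_congr fun k _ => ?_) fun _ _ => rfl
      have : r k = -v → r k ≠ 0 := fun h => by simpa [h] using hv
      tauto
    have hc1 : (univ.filter fun k => r k = -v).card ≤ m + 1 := by
      rw [← hr]
      exact card_le_card fun k hk => by
        simp only [mem_filter, mem_univ, true_and] at hk ⊢
        simpa [hk] using hv
    have hc2 : (univ.filter fun k => r k ≠ 0 ∧ r k ≠ -v).card ≤ m + 1 := by
      rw [← hr]
      exact card_le_card fun k hk => by
        simp only [mem_filter, mem_univ, true_and] at hk ⊢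
        exact hk.1
    have b1 := norm_sum_cube_le _ (fun k => permMean (r + coordVec k v)) hc1
    have b2 := norm_sum_cube_le _ (fun k => permMean (r + coordVec k v)) hc2
    have b3 := norm_sum_cube_sub_le _ (fun k => permMean (r + coordVec k v)) hc1
    rw [hsplit]
    set X := ∑ k with r k = -v, permMean (r + coordVec k v)
    set Y := ∑ k with r k ≠ 0 ∧ r k ≠ -v, permMean (r + coordVec k v)
    have b4 := hC X Y
    push_cast at b1 b2 b3
    calc _ = ‖((X + Y) ^ 3 - X ^ 3) +
          (X ^ 3 - ∑ k with r k = -v, permMean (r + coordVec k v) ^ 3)‖ := by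
          congr 1
          ring
      _ ≤ _ := norm_add_le _ _
      _ ≤ (η * ‖X‖ ^ 3 + C * ‖Y‖ ^ 3) + _ := add_le_add b4 b3
      _ ≤ _ := by
          rw [mul_assoc η, mul_assoc C]
          gcongr
          exact le_of_eq (by congr)
  have hT : ((m : ℂ) + 2) * thirdMoment n (m + 2) = ∑ i : ZMod n, ∑ v with v ≠ 0,
      ∑ r with hammingNorm r = m + 1 ∧ r i = 0, permMean (r + coordVec i v) ^ 3 := by
    rw [← nsmul_sum_hammingNorm_succ (m + 1) (fun r => permMean r ^ 3), nsmul_eq_mul, thirdMoment]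
    push_cast
    ring
  have hT2 : ((n : ℂ) - (m + 1)) ^ 3 * ((m + 2) * thirdMoment n (m + 2)) =
      -∑ i : ZMod n, ∑ v with v ≠ 0, ∑ r with hammingNorm r = m + 1 ∧ r i = 0,
        (∑ k with r k ≠ 0, permMean (r + coordVec k v)) ^ 3 := by
    rw [hT]
    simp_rw [mul_sum, ← sum_neg_distrib]
    refine sum_congr rfl fun i _ => sum_congr rfl fun v hv => sum_congr rfl fun r hr => ?_
    obtain ⟨hr1, hr2⟩ := (mem_filter.1 hr).2
    have h := permMean_recursion r hr2 (mem_filter.1 hv).2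
    rw [hr1] at h
    push_cast at h
    rw [← mul_pow, h]
    ring
  rw [hT2, ← sum_cancel_cube, ← norm_neg, neg_add, neg_neg, ← sub_eq_add_neg]
  simp_rw [← sum_sub_distrib]
  have hb1 := sum_cancel_norm_cube_le (n := n) (m := m) (by omega)
  have hb2 := sum_merge_norm_cube_le (n := n) (m + 1)
  have hb3 := sum_cancel_repeated_le (n := n) m
  calc _ ≤ ∑ i : ZMod n, ∑ v with v ≠ 0, ∑ r with hammingNorm r = m + 1 ∧ r i = 0,
      (η * (m + 1) ^ 2 * ∑ k with r k = -v, ‖permMean (r + coordVec k v)‖ ^ 3 +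
      C * (m + 1) ^ 2 * ∑ k with r k ≠ 0 ∧ r k ≠ -v, ‖permMean (r + coordVec k v)‖ ^ 3 +
      ((m + 1) ^ 2 + 1) * ∑ k with r k = -v,
        (if ∃ l ∈ univ.filter (fun k => r k = -v), l ≠ k then
          ‖permMean (r + coordVec k v)‖ ^ 3 else 0)) := by
        refine norm_sum_le_of_le _ fun i _ => norm_sum_le_of_le _ fun v hv =>
          norm_sum_le_of_le _ fun r hr => ?_
        exact hpt r v (mem_filter.1 hv).2 (mem_filter.1 hr).2.1
    _ ≤ η * (m + 1) ^ 2 * (n ^ 3 * absThirdMoment n m) +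
        C * (m + 1) ^ 2 * (n ^ 2 * (m + 1 : ℕ) * absThirdMoment n (m + 1)) +
        ((m + 1) ^ 2 + 1) * (n ^ 2 * m * absThirdMoment n m) := by
        simp_rw [sum_add_distrib, ← mul_sum]
        gcongr
    _ ≤ η * (m + 1) ^ 2 * (n ^ 3 * 11 ^ m) +
        C * (m + 1) ^ 2 * (n ^ 2 * (m + 1 : ℕ) * 11 ^ (m + 1)) +
        ((m + 1) ^ 2 + 1) * (n ^ 2 * m * 11 ^ m) := by gcongr
    _ = _ := by push_cast; ring

/-- The limit of `thirdMoment n m` as `n → ∞`: the coefficients of `exp (-x ^ 2 / 2)`. -/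
noncomputable def gaussCoeff : ℕ → ℂ
  | 0 => 1
  | 1 => 0
  | m + 2 => -(gaussCoeff m / (m + 2))

theorem thirdMoment_zero (n : ℕ) [NeZero n] : thirdMoment n 0 = 1 := by
  simp [thirdMoment, hammingNorm_eq_zero, filter_eq', permMean_zero]

theorem thirdMoment_one (n : ℕ) [NeZero n] : thirdMoment n 1 = 0 := by
  have h := nsmul_sum_hammingNorm_succ (n := n) 0 (fun r => permMean r ^ 3)
  rw [zero_add, one_smul] at h
  rw [thirdMoment, h]
  refine sum_eq_zero fun i _ => sum_eq_zero fun v hv => sum_eq_zero fun r hr => ?_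
  simp only [mem_filter, mem_univ, true_and, hammingNorm_eq_zero] at hr hv
  rw [hr.1, zero_add, permMean_coordVec i hv]
  simp

theorem tendsto_natCast_sub_div (c : ℂ) :
    Tendsto (fun n : ℕ => (((n + 1 : ℕ) : ℂ) - c) / ((n + 1 : ℕ) : ℂ)) atTop (𝓝 1) := by
  have h := ((tendsto_inv_atTop_nhds_zero_nat (𝕜 := ℂ)).comp (tendsto_add_atTop_nat 1)).const_mul c
  have h2 := h.const_sub 1
  rw [mul_zero, sub_zero] at h2
  refine h2.congr fun n => ?_
  have : ((n + 1 : ℕ) : ℂ) ≠ 0 := Nat.cast_ne_zero.2 (Nat.succ_ne_zero n)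
  simp only [Function.comp_apply]
  field_simp

theorem tendsto_thirdMoment (m : ℕ) :
    Tendsto (fun n : ℕ => thirdMoment (n + 1) m) atTop (𝓝 (gaussCoeff m)) := by
  induction m using Nat.twoStepInduction with
  | zero => simp [thirdMoment_zero, gaussCoeff]
  | one => simp [thirdMoment_one, gaussCoeff]
  | more m ih _ =>
    obtain ⟨A, hA0, hA⟩ := exists_thirdMoment_recursion m
    let D : ℕ → ℂ := fun n => (((n + 1 : ℕ) : ℂ) - (m + 1)) ^ 3 *
      ((m + 2) * thirdMoment (n + 1) (m + 2)) + (((n + 1 : ℕ) : ℂ) - m) *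
      (((n + 1 : ℕ) : ℂ) - m - 1) * (((n + 1 : ℕ) : ℂ) - 1) * thirdMoment (n + 1) m
    have hD : Tendsto (fun n => D n / ((n + 1 : ℕ) : ℂ) ^ 3) atTop (𝓝 0) := by
      rw [Metric.tendsto_atTop]
      intro ε hε
      obtain ⟨B, hB⟩ := hA (ε / (2 * (A + 1))) (by positivity)
      obtain ⟨N, hN⟩ := exists_nat_gt (2 * |B| / ε)
      refine ⟨max N (2 * (m + 2)), fun n hn => ?_⟩
      have hn1 : N ≤ n := (le_max_left _ _).trans hn
      have hn2 : 2 * (m + 2) ≤ n + 1 := ((le_max_right _ _).trans hn).trans (Nat.le_succ n)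
      have hx0 : (0 : ℝ) < ((n + 1 : ℕ) : ℝ) := by positivity
      have hx : 2 * |B| / ε < ((n + 1 : ℕ) : ℝ) :=
        hN.trans_le (by exact_mod_cast hn1.trans (Nat.le_succ n))
      have h := hB (n + 1) hn2
      set x : ℝ := ((n + 1 : ℕ) : ℝ)
      rw [dist_zero_right, norm_div, norm_pow, Complex.norm_natCast, div_lt_iff₀ (by positivity)]
      refine h.trans_lt ?_
      have h1 : ε / (2 * (A + 1)) * A ≤ ε / 2 := by
        rw [div_mul_eq_mul_div, div_le_div_iff₀ (by positivity) (by positivity)]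
        nlinarith
      have h2 : B * x ^ 2 < ε / 2 * x ^ 3 := by
        rw [div_lt_iff₀ hε] at hx
        calc B * x ^ 2 ≤ |B| * x ^ 2 := by
              gcongr
              exact le_abs_self B
          _ = (2 * |B|) * (x ^ 2 / 2) := by ring
          _ < (x * ε) * (x ^ 2 / 2) := by gcongr
          _ = _ := by ring
      have h3 : ε / (2 * (A + 1)) * A * x ^ 3 ≤ ε / 2 * x ^ 3 := by gcongr
      linarith
    have hlim := (hD.sub ((((tendsto_natCast_sub_div m).mul (tendsto_natCast_sub_div (m + 1))).mul
      (tendsto_natCast_sub_div 1)).mul ih)).div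
      (((tendsto_natCast_sub_div (m + 1)).pow 3).mul (tendsto_const_nhds (x := (m : ℂ) + 2)))
      (by
        rw [one_pow, one_mul]
        exact_mod_cast Nat.succ_ne_zero (m + 1))
    have hval : (0 - 1 * 1 * 1 * gaussCoeff m) / (1 ^ 3 * ((m : ℂ) + 2)) = gaussCoeff (m + 2) := by
      rw [gaussCoeff]
      ring
    rw [hval] at hlim
    refine hlim.congr' ?_
    filter_upwards [eventually_gt_atTop m] with n hn
    have h1 : ((n + 1 : ℕ) : ℂ) ≠ 0 := Nat.cast_ne_zero.2 (Nat.succ_ne_zero n)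
    have h2 : ((n + 1 : ℕ) : ℂ) - (m + 1) ≠ 0 := by
      rw [sub_ne_zero]
      exact_mod_cast (by omega : n + 1 ≠ m + 1)
    have h3 : (m : ℂ) + 2 ≠ 0 := by exact_mod_cast Nat.succ_ne_zero (m + 1)
    simp only [D, Pi.div_apply]
    field_simp
    ring

/-! ### Summation over all support sizes -/

theorem gaussCoeff_two_mul (k : ℕ) : gaussCoeff (2 * k) = (-1 / 2) ^ k / k ! := by
  induction k with
  | zero => simp [gaussCoeff]
  | succ k ih =>
    rw [show 2 * (k + 1) = 2 * k + 2 by ring, gaussCoeff, ih, Nat.factorial_succ]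
    have h1 := factorial_ne_zero_complex k
    have h2 : (k : ℂ) + 1 ≠ 0 := by exact_mod_cast Nat.succ_ne_zero k
    have h3 : (2 * k : ℂ) + 2 ≠ 0 := by
      rw [show (2 * k : ℂ) + 2 = 2 * (k + 1) by ring]
      exact mul_ne_zero two_ne_zero h2
    push_cast
    field_simp
    ring

theorem gaussCoeff_two_mul_add_one (k : ℕ) : gaussCoeff (2 * k + 1) = 0 := by
  induction k with
  | zero => simp [gaussCoeff]
  | succ k ih =>
    rw [show 2 * (k + 1) + 1 = 2 * k + 1 + 2 by ring, gaussCoeff, ih]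
    simp

theorem hasSum_gaussCoeff : HasSum gaussCoeff (Complex.exp (-1 / 2)) := by
  have h1 : HasSum (fun k => gaussCoeff (2 * k)) (Complex.exp (-1 / 2)) := by
    simp_rw [gaussCoeff_two_mul]
    rw [Complex.exp_eq_exp_ℂ]
    exact NormedSpace.expSeries_div_hasSum_exp (-1 / 2 : ℂ)
  have h2 : HasSum (fun k => gaussCoeff (2 * k + 1)) 0 := by
    simp_rw [gaussCoeff_two_mul_add_one]
    exact hasSum_zero
  simpa using h1.even_add_odd h2

/-- For sufficiently small `δ`, the third moment over the vectors with at most `δ n` nonzero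
coordinates tends to `exp (-1 / 2)`, by dominated convergence. -/
theorem exists_tendsto_sum_thirdMoment : ∃ δ : ℝ, 0 < δ ∧ δ < 1 / 2 ∧
    Tendsto (fun n : ℕ => ∑ m ∈ range (⌊δ * ((n + 1 : ℕ) : ℝ)⌋₊ + 1), thirdMoment (n + 1) m) atTop
      (𝓝 (Complex.exp (-1 / 2))) := by
  obtain ⟨δ, hδ0, hδ1, M, hM⟩ := exists_absThirdMoment_le
  refine ⟨δ, hδ0, hδ1, ?_⟩
  let f : ℕ → ℕ → ℂ := fun n m =>
    if m ∈ range (⌊δ * ((n + 1 : ℕ) : ℝ)⌋₊ + 1) then thirdMoment (n + 1) m else 0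
  have hmem : ∀ n m : ℕ, m ∈ range (⌊δ * ((n + 1 : ℕ) : ℝ)⌋₊ + 1) ↔
      (m : ℝ) ≤ δ * ((n + 1 : ℕ) : ℝ) := fun n m => by
    rw [mem_range, Nat.lt_succ_iff, Nat.le_floor_iff (by positivity)]
  have h := tendsto_tsum_of_dominated_convergence (f := f) (g := gaussCoeff)
    (bound := fun m => if m < M then 11 ^ m else (1 / 2) ^ m) (𝓕 := atTop) ?_ ?_ ?_
  · rw [hasSum_gaussCoeff.tsum_eq] at h
    refine h.congr fun n => ?_
    rw [tsum_eq_sum (s := range (⌊δ * ((n + 1 : ℕ) : ℝ)⌋₊ + 1)) fun m hm => if_neg hm]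
    exact sum_congr rfl fun m hm => if_pos hm
  · refine (summable_geometric_of_lt_one (by norm_num) (by norm_num :
      (1 / 2 : ℝ) < 1)).congr_cofinite ?_
    rw [Nat.cofinite_eq_atTop]
    filter_upwards [eventually_ge_atTop M] with m hm
    rw [if_neg (not_lt.2 hm)]
  · intro m
    refine (tendsto_thirdMoment m).congr' ?_
    have h1 : Tendsto (fun n : ℕ => δ * ((n + 1 : ℕ) : ℝ)) atTop atTop :=
      (tendsto_natCast_atTop_atTop.comp (tendsto_add_atTop_nat 1)).const_mul_atTop hδ0
    filter_upwards [h1.eventually_ge_atTop (m : ℝ)] with n hn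
    exact (if_pos ((hmem n m).2 hn)).symm
  · refine Eventually.of_forall fun n m => ?_
    simp only [f]
    split_ifs with h1 h2 h2
    · refine (norm_thirdMoment_le m).trans (absThirdMoment_le ?_)
      have h3 := (hmem n m).1 h1
      have h4 : (2 * m : ℝ) ≤ ((n + 1 : ℕ) : ℝ) := by
        have : (0 : ℝ) ≤ ((n + 1 : ℕ) : ℝ) := by positivity
        nlinarith
      exact_mod_cast h4
    · exact (norm_thirdMoment_le m).trans (hM (n + 1) m (not_lt.1 h2) ((hmem n m).1 h1))
    · rw [norm_zero]; positivity
    · rw [norm_zero]; positivity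

section

variable {n : ℕ} [NeZero n]

theorem mult_add_mult_le (r : ZMod n → ZMod n) {a b : ZMod n} (h : a ≠ b) :
    mult r a + mult r b ≤ n := by
  have h1 := sum_mult r
  rw [ZMod.card] at h1
  refine le_trans ?_ h1.le
  rw [← sum_pair h]
  exact sum_le_sum_of_subset (subset_univ _)

theorem sum_range_thirdMoment (d : ℕ) : ∑ m ∈ range (d + 1), thirdMoment n m =
    ∑ r : ZMod n → ZMod n with hammingNorm r ≤ d, permMean r ^ 3 := by
  rw [← sum_fiberwise_of_maps_to (s := univ.filter fun r : ZMod n → ZMod n => hammingNorm r ≤ d)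
    (t := range (d + 1)) (g := hammingNorm)
    (fun r hr => mem_range.2 (Nat.lt_succ_of_le (mem_filter.1 hr).2))]
  refine sum_congr rfl fun m hm => ?_
  rw [filter_filter, thirdMoment]
  refine sum_congr (filter_congr fun r _ => ?_) fun _ _ => rfl
  have := mem_range.1 hm
  constructor
  · rintro rfl
    exact ⟨by omega, rfl⟩
  · exact fun h => h.2

/-- Translating by constants reduces the vectors with a dominant value `c`, for each of the `n`
possible `c`, to those of small support. -/
theorem sum_permMean_cube_split (hn : Odd n) {d : ℕ} (hd : 2 * d < n) :
    ∑ r : ZMod n → ZMod n, permMean r ^ 3 =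
      n * ∑ m ∈ range (d + 1), thirdMoment n m +
      ∑ r : ZMod n → ZMod n with ∀ a, mult r a ≤ n - d - 1, permMean r ^ 3 := by
  rw [sum_range_thirdMoment,
    ← sum_filter_not_add_sum_filter univ (fun r : ZMod n → ZMod n => ∀ a, mult r a ≤ n - d - 1)]
  congr 1
  have h1 : ∀ r : ZMod n → ZMod n, (if ¬ ∀ a, mult r a ≤ n - d - 1 then permMean r ^ 3 else 0) =
      ∑ c, if n - d ≤ mult r c then permMean r ^ 3 else 0 := by
    intro r
    by_cases h : ∀ a, mult r a ≤ n - d - 1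
    · rw [if_neg (not_not.2 h)]
      refine (sum_eq_zero fun c _ => if_neg ?_).symm
      have := h c
      omega
    · rw [if_pos h]
      push Not at h
      obtain ⟨c, hc⟩ := h
      have hc : n - d ≤ mult r c := by omega
      rw [sum_eq_single c, if_pos hc]
      · intro b _ hb
        refine if_neg fun h => ?_
        have := mult_add_mult_le r hb
        omega
      · simp
  rw [sum_filter]
  simp_rw [h1]
  rw [sum_comm]
  have h2 : ∀ c : ZMod n, ∑ r : ZMod n → ZMod n,
      (if n - d ≤ mult r c then permMean r ^ 3 else 0) =
      ∑ r : ZMod n → ZMod n with hammingNorm r ≤ d, permMean r ^ 3 := by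
    intro c
    rw [sum_filter]
    refine Fintype.sum_equiv (Equiv.subRight fun _ => c) _ _ fun r => ?_
    have h3 : permMean ((Equiv.subRight fun _ => c) r) = permMean r := by
      rw [← permMean_add_const hn _ c]
      congr 1
      ext i
      simp
    have h4 : mult r c = n - hammingNorm ((Equiv.subRight fun _ => c) r) := by
      rw [← mult_zero_eq]
      simp [mult, sub_eq_zero]
    have h5 := hammingNorm_le ((Equiv.subRight fun _ => c) r)
    rw [h3, h4]
    refine if_congr ?_ rfl rfl
    omega
  simp_rw [h2]
  rw [sum_const, card_univ, ZMod.card, nsmul_eq_mul]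

end

/-- The circle method asymptotic: the vectors with a dominant value give the main term, all others
give `o(1)`. -/
theorem sum_permMean_cube_asymptotic {ε : ℝ} (hε : 0 < ε) :
    ∃ N : ℕ, ∀ n : ℕ, N ≤ n → ∀ [NeZero n], Odd n →
      ‖(∑ r : ZMod n → ZMod n, permMean r ^ 3) / n - Complex.exp (-1 / 2)‖ ≤ ε := by
  obtain ⟨δ, hδ0, hδ1, hlim⟩ := exists_tendsto_sum_thirdMoment
  obtain ⟨N₁, hN₁⟩ := Metric.tendsto_atTop.1 hlim (ε / 2) (by positivity)
  obtain ⟨N₂, hN₂⟩ := eventually_sum_norm_cube_le hδ0 (by linarith) (half_pos hε)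
  refine ⟨max (N₁ + 1) N₂, fun n hn _ hodd => ?_⟩
  have hn0 : (0 : ℝ) < n := by exact_mod_cast NeZero.pos n
  have hn1 : (1 : ℝ) ≤ n := by exact_mod_cast NeZero.pos n
  set d := ⌊δ * (n : ℝ)⌋₊ with hd
  have hdle : (d : ℝ) ≤ δ * n := Nat.floor_le (by positivity)
  have hdlt : δ * n < d + 1 := Nat.lt_floor_add_one _
  have h2d : 2 * d < n := by
    have : 2 * (d : ℝ) < n := by nlinarith
    exact_mod_cast this
  have hL : ((n - d - 1 : ℕ) : ℝ) ≤ (1 - δ) * n := by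
    rw [Nat.cast_sub (by omega), Nat.cast_sub (by omega)]
    push_cast
    linarith
  have hR : ‖∑ r : ZMod n → ZMod n with ∀ a, mult r a ≤ n - d - 1, permMean r ^ 3‖ ≤ ε / 2 := by
    refine (norm_sum_le _ _).trans ?_
    simp_rw [norm_pow]
    exact hN₂ n ((le_max_right _ _).trans hn) _ hL
  have hM : ‖∑ m ∈ range (d + 1), thirdMoment n m - Complex.exp (-1 / 2)‖ ≤ ε / 2 := by
    obtain ⟨k, rfl⟩ : ∃ k, n = k + 1 := ⟨n - 1, by have := NeZero.pos n; omega⟩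
    have := hN₁ k (by have := (le_max_left _ _).trans hn; omega)
    rw [dist_eq_norm] at this
    exact this.le
  rw [sum_permMean_cube_split hodd h2d]
  have hnC : (n : ℂ) ≠ 0 := Nat.cast_ne_zero.2 (NeZero.ne n)
  rw [add_div, mul_div_cancel_left₀ _ hnC, add_sub_right_comm]
  calc _ ≤ _ := norm_add_le _ _
    _ ≤ ε / 2 + ε / 2 := by
        refine add_le_add hM ?_
        rw [norm_div, Complex.norm_natCast]
        exact (div_le_self (norm_nonneg _) hn1).trans hR
    _ = ε := add_halves ε

/-! ### The asymptotic formula and its consequences -/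

/-- The error term in the asymptotic formula for `s n`, set to zero for even `n`. -/
noncomputable def relError (n : ℕ) : ℝ :=
  if Odd n then (s n : ℝ) * n ^ (n - 1) / (n ! : ℝ) ^ 3 - Real.exp (-1 / 2) else 0

theorem tendsto_relError : Tendsto relError atTop (𝓝 0) := by
  rw [Metric.tendsto_atTop]
  intro ε hε
  obtain ⟨N, hN⟩ := sum_permMean_cube_asymptotic (half_pos hε)
  refine ⟨N, fun n hn => ?_⟩
  rw [dist_zero_right, relError]
  split_ifs with hodd
  · have : NeZero n := ⟨by rintro rfl; simp at hodd⟩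
    have h := hN n hn hodd
    have hnC : (n : ℂ) ≠ 0 := Nat.cast_ne_zero.2 (NeZero.ne n)
    have h2 : (∑ r : ZMod n → ZMod n, permMean r ^ 3) / n - Complex.exp (-1 / 2) =
        (((s n : ℝ) * n ^ (n - 1) / (n ! : ℝ) ^ 3 - Real.exp (-1 / 2) : ℝ) : ℂ) := by
      rw [sum_permMean_cube]
      push_cast
      congr 1
      rw [← mul_pow_sub_one (NeZero.ne n) (n : ℂ)]
      field_simp
    rw [h2, Complex.norm_real] at h
    exact h.trans_lt (half_lt_self hε)
  · simpa using hε

theorem s_eq_of_odd {n : ℕ} (hn : Odd n) :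
    (s n : ℝ) = (Real.exp (-1 / 2) + relError n) * (n ! : ℝ) ^ 3 / (n : ℝ) ^ (n - 1) := by
  have hn0 : (n : ℝ) ≠ 0 := by
    rintro h
    rw [Nat.cast_eq_zero] at h
    subst h
    simp at hn
  rw [relError, if_pos hn]
  field_simp
  ring

theorem tendsto_log_factorial :
    Tendsto (fun n : ℕ => Real.log (n !) / n - Real.log n) atTop (𝓝 (-1)) := by
  have hlog : Tendsto (fun n : ℕ => Real.log n / n) atTop (𝓝 0) := by
    have h := Real.isLittleO_log_id_atTop.tendsto_div_nhds_zero
    exact h.comp tendsto_natCast_atTop_atTop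
  have hup : Tendsto (fun n : ℕ => (1 : ℝ) / n + Real.log n / n - 1) atTop (𝓝 (-1)) := by
    simpa using ((tendsto_const_div_atTop_nhds_zero_nat (1 : ℝ)).add hlog).sub_const 1
  refine tendsto_of_tendsto_of_tendsto_of_le_of_le' tendsto_const_nhds hup ?_ ?_
  · filter_upwards [eventually_gt_atTop 0] with n hn
    have hn0 : (0 : ℝ) < n := by exact_mod_cast hn
    have h := Real.pow_div_factorial_le_exp (n : ℝ) hn0.le n
    have h2 := Real.log_le_log (by positivity) h
    rw [Real.log_exp, Real.log_div (by positivity) (by positivity), Real.log_pow] at h2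
    have h3 : (n * Real.log n - n) / n ≤ Real.log (n !) / n := by
      gcongr
      linarith
    have h4 : (n * Real.log n - n) / n = Real.log n - 1 := by field_simp
    linarith
  · filter_upwards [eventually_gt_atTop 0] with n hn
    have hn0 : (0 : ℝ) < n := by exact_mod_cast hn
    have h := Real.log_le_log (by positivity) (factorial_mul_exp_le hn.ne')
    rw [Real.log_mul (by positivity) (by positivity), Real.log_exp,
      Real.log_mul (by positivity) (by positivity), Real.log_mul (by positivity) (by positivity),
      Real.log_exp, Real.log_pow] at h
    have h3 : Real.log (n !) / n ≤ (1 + Real.log n + n * Real.log n - n) / n := by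
      gcongr
      linarith
    have h4 : (1 + Real.log n + n * Real.log n - n) / n =
        1 / n + Real.log n / n - 1 + Real.log n := by field_simp; ring
    linarith

theorem eventually_exp_add_relError_pos : ∀ᶠ n : ℕ in atTop, 0 < Real.exp (-1 / 2) + relError n := by
  have h := tendsto_relError.const_add (Real.exp (-1 / 2))
  rw [add_zero] at h
  exact h.eventually (lt_mem_nhds (Real.exp_pos _))

theorem s_div_eq_of_odd {n : ℕ} (hn : Odd n) :
    (s n : ℝ) / (n ! : ℝ) ^ 2 = (Real.exp (-1 / 2) + relError n) * n ! / (n : ℝ) ^ (n - 1) := by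
  rw [s_eq_of_odd hn]
  field_simp

theorem tendsto_log_s : Tendsto (fun n : ℕ => 1 / (n : ℝ) * Real.log ((s n : ℝ) / (n ! : ℝ) ^ 2))
    (atTop ⊓ 𝓟 {n : ℕ | Odd n}) (𝓝 (-1)) := by
  have hlog : Tendsto (fun n : ℕ => Real.log n / n) atTop (𝓝 0) :=
    Real.isLittleO_log_id_atTop.tendsto_div_nhds_zero.comp tendsto_natCast_atTop_atTop
  have h1 : Tendsto (fun n : ℕ => Real.log (Real.exp (-1 / 2) + relError n)) atTop
      (𝓝 (Real.log (Real.exp (-1 / 2) + 0))) :=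
    (tendsto_relError.const_add _).log (by positivity)
  have h2 : Tendsto (fun n : ℕ => Real.log (Real.exp (-1 / 2) + relError n) * (1 / n)
      + (Real.log (n !) / n - Real.log n) + Real.log n / n) atTop (𝓝 (-1)) := by
    simpa using ((h1.mul tendsto_one_div_atTop_nhds_zero_nat).add tendsto_log_factorial).add hlog
  refine (h2.mono_left inf_le_left).congr' ?_
  rw [EventuallyEq, eventually_inf_principal]
  filter_upwards [eventually_exp_add_relError_pos, eventually_gt_atTop 0] with n hpos hn hodd
  have hn0 : (0 : ℝ) < n := by exact_mod_cast hn
  rw [s_div_eq_of_odd hodd, Real.log_div (by positivity) (by positivity),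
    Real.log_mul hpos.ne' (by positivity), Real.log_pow, Nat.cast_sub hn]
  push_cast
  field_simp
  ring

theorem exists_exponential_bounds : ∃ c₁ c₂ : ℝ, 0 < c₁ ∧ c₂ < 1 ∧
    ∀ᶠ n : ℕ in atTop, Odd n →
      c₁ ^ n * (n ! : ℝ) ^ 2 ≤ (s n : ℝ) ∧ (s n : ℝ) ≤ c₂ ^ n * (n ! : ℝ) ^ 2 := by
  refine ⟨Real.exp (-2), Real.exp (-1 / 2), Real.exp_pos _, by
    rw [Real.exp_lt_one_iff]; norm_num, ?_⟩
  have h1 := eventually_inf_principal.1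
    (tendsto_log_s.eventually (lt_mem_nhds (show (-2 : ℝ) < -1 by norm_num)))
  have h2 := eventually_inf_principal.1
    (tendsto_log_s.eventually (gt_mem_nhds (show (-1 : ℝ) < -1 / 2 by norm_num)))
  filter_upwards [h1, h2, eventually_exp_add_relError_pos, eventually_gt_atTop 0] with
    n h1 h2 hpos hn hodd
  have h1 := h1 hodd
  have h2 := h2 hodd
  have hn0 : (0 : ℝ) < n := by exact_mod_cast hn
  have hx : 0 < (s n : ℝ) / (n ! : ℝ) ^ 2 := by
    rw [s_div_eq_of_odd hodd]
    positivity
  rw [one_div_mul_eq_div, lt_div_iff₀ hn0] at h1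
  rw [one_div_mul_eq_div, div_lt_iff₀ hn0] at h2
  rw [Real.lt_log_iff_exp_lt hx, mul_comm, Real.exp_nat_mul, lt_div_iff₀ (by positivity)] at h1
  rw [Real.log_lt_iff_lt_exp hx, mul_comm, Real.exp_nat_mul, div_lt_iff₀ (by positivity)] at h2
  exact ⟨h1.le, h2.le⟩

end Semiqueens

theorem theorem1 :
    -- the asymptotic formula for odd `n`
    (∃ ε : ℕ → ℝ, Tendsto ε atTop (𝓝 0) ∧
      ∀ n : ℕ, Odd n →
        (Semiqueens.s n : ℝ) = (Real.exp (-1 / 2) + ε n) * (n ! : ℝ) ^ 3 / (n : ℝ) ^ (n - 1)) ∧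
    -- the equivalent counting problems
    (∀ n : ℕ, 0 < n →
      Semiqueens.s n = n ! * (Semiqueens.orthomorphisms n).ncard ∧
      Semiqueens.s n = n ! * (Semiqueens.semiqueenArrangements n).ncard ∧
      Semiqueens.s n = n ! * (Semiqueens.cyclicTransversals n).ncard) ∧
    -- Vardi's conjecture
    (∃ c₁ c₂ : ℝ, 0 < c₁ ∧ c₂ < 1 ∧
      ∀ᶠ n : ℕ in atTop, Odd n →
        c₁ ^ n * (n ! : ℝ) ^ 2 ≤ (Semiqueens.s n : ℝ) ∧
        (Semiqueens.s n : ℝ) ≤ c₂ ^ n * (n ! : ℝ) ^ 2) ∧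
    -- Wanless's conjecture
    Tendsto (fun n : ℕ => 1 / (n : ℝ) * Real.log ((Semiqueens.s n : ℝ) / (n ! : ℝ) ^ 2))
      (atTop ⊓ 𝓟 {n : ℕ | Odd n}) (𝓝 (-1)) := by
  refine ⟨⟨Semiqueens.relError, Semiqueens.tendsto_relError, fun n hn => Semiqueens.s_eq_of_odd hn⟩,
    fun n hn => ?_, Semiqueens.exists_exponential_bounds, Semiqueens.tendsto_log_s⟩
  have : NeZero n := ⟨hn.ne'⟩
  rw [Semiqueens.ncard_semiqueenArrangements, Semiqueens.ncard_cyclicTransversals]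
  have h := Semiqueens.s_eq_factorial_mul_orthomorphisms n
  exact ⟨h, h, h⟩
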